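/- Setting. Let $\mathsf X,\mathsf Y$ be Polish spaces with their Borel $\sigma$-algebras. Consider a state space model with initial law $\chi$ on $\mathsf X$, transition kernel $M(x,dx')=m(x,x')\,\nu(dx')$ ($\nu$ $\sigma$-finite, $m\ge 0$ jointly measurable) and observation density $g(x,\cdot)$ with respect to a $\sigma$-finite measure on $\mathsf Y$. Fix observations $y_0,y_1,\dots$ and a horizon $T\in\mathbb N$, and put $g_t(x)=g(x,y_t)$. For bounded measurable $h:\mathsf X^{T+1}\to\mathbb R$ the joint smoothing distribution is $$\phi_{0:T|T}(h)=\frac{\int\cdots\int \chi(dx_0)\prod_{u=1}^T g_{u-1}(x_{u-1})M(x_{u-1},dx_u)\,g_T(x_T)\,h(x_{0:T})}{\int\cdots\int \chi(dx_0)\prod_{u=1}^T g_{u-1}(x_{u-1})M(x_{u-1},dx_u)\,g_T(x_T)} .$$ Forward pass (auxiliary particle filter with $N\ge1$ particles). Let $\rho_0$ be a probability measure with $\chi\ll\rho_0$, $\vartheta_t\ge0$ measurable adjustment multiplier functions, and $q_t(x,\cdot)$ Markov transition densities with respect to $\nu$. Put $\omega_0(x)=\frac{d\chi}{d\rho_0}(x)g_0(x)$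 and $\omega_t(x,x')=\frac{m(x,x')g_t(x')}{\vartheta_t(x)q_t(x,x')}$ for $t\ge1$ (with $a/0=\infty$ for $a>0$ and $0/0=0$). The particles $\xi_0^1,\dots,\xi_0^N$ are i.i.d. with law $\rho_0$ and have weights $\omega_0^i=\omega_0(\xi_0^i)$. Given the $\sigma$-algebra $\mathcal F_{t-1}^N$ generated by the particles and weights up to time $t-1$, the pairs $(I_t^i,\xi_t^i)$, $1\le i\le N$, are i.i.d. with law on $\{1,\dots,N\}\times\mathsf X$ proportional to $\omega_{t-1}^i\,\vartheta_t(\xi_{t-1}^i)\,q_t(\xi_{t-1}^i,x)\,\nu(dx)$, and $\omega_t^i=\omega_t(\xi_{t-1}^{I_t^i},\xi_t^i)$. Backward pass (FFBSi). Given $\mathcal F_T^N$, the index paths $J_{0:T}^1,\dots,J_{0:T}^N$ are i.i.d. with $$\mathbb P[J_{0:T}=j_{0:T}\mid\mathcal F_T^N]=\frac{\omega_T^{j_T}}{\sum_l\omega_T^l}\prod_{t=0}^{T-1}\Lambda_t^N(j_{t+1},j_t),\qquad \Lambda_t^N(i,j)=\frac{\omega_t^j m(\xi_t^j,\xi_{t+1}^i)}{\sum_l\omega_t^l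 m(\xi_t^l,\xi_{t+1}^i)},$$ and the FFBSi estimator is $\tilde\phi_{0:T|T}(h)=N^{-1}\sum_{\ell=1}^N h(\xi_0^{J_0^\ell},\dots,\xi_T^{J_T^\ell})$. If all weights vanish at some time, the variables produced from then on may be arbitrary (particles in $\mathsf X$, indices in $\{1,\dots,N\}$). Statement. Assume that $g_t>0$ for all $0\le t\le T$ and $\sup_{0\le t\le T}|g_t|_\infty<\infty$, and that $\sup_{1\le t\le T}|\vartheta_t|_\infty<\infty$ and $\sup_{0\le t\le T}|\omega_t|_\infty<\infty$ (for $\omega_0$, the $\rho_0$-essential supremum). Then there exist constants $0<B<\infty$ and $0<C<\infty$, which depend on the model, the observations, the proposals and $T$ but not on $N$, $\epsilon$ or $h$, such that for all $N\ge1$, all $\epsilon>0$ and all bounded measurable $h:\mathsf X^{T+1}\to\mathbb R$, $$\mathbb P\bigl[\,|\tilde\phi_{0:T|T}(h)-\phi_{0:T|T}(h)|\ge\epsilon\,\bigr]\le B\,e^{-CN\epsilon^2/\mathrm{osc}(h)^2},\qquad \mathrm{osc}(h)=\sup_{x,x'}|h(x)-h(x')|,$$ where for $\mathrm{osc}(h)=0$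 the right-hand side is read as $0$. -/

import Mathlib

open MeasureTheory ProbabilityTheory
open scoped ENNReal NNReal

/-- A fully dominated state space model. `init` is the law of `X₀`, the transition kernel is
`M(x, dx') = m(x, x') ν(dx')`, and given `X_t = x` the observation has density `g(x, ·)` with
respect to `obsRef`. -/
structure StateSpaceModel (X Y : Type*) [MeasurableSpace X] [MeasurableSpace Y] where
  init : Measure X
  isProb_init : IsProbabilityMeasure init
  ν : Measure X
  sigmaFinite_ν : SigmaFinite ν
  m : X → X → ℝ≥0
  measurable_m : Measurable (Function.uncurry m)
  lintegral_m : ∀ x, ∫⁻ x', (m x x' : ℝ≥0∞) ∂ν = 1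
  obsRef : Measure Y
  sigmaFinite_obsRef : SigmaFinite obsRef
  g : X → Y → ℝ≥0
  measurable_g : Measurable (Function.uncurry g)
  lintegral_g : ∀ x, ∫⁻ y, (g x y : ℝ≥0∞) ∂obsRef = 1

/-- The user-chosen ingredients of an auxiliary particle filter for the model `S`: the initial
instrumental distribution `ρ₀` (dominating the initial law), the adjustment multiplier functions
`ϑ t` and the densities `q t` (with respect to `ν`) of the Markovian proposal kernels; only the
values of `ϑ t` and `q t` at `t ≥ 1` are used. -/
structure AuxiliaryProposal {X Y : Type*} [MeasurableSpace X] [MeasurableSpace Y]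
    (S : StateSpaceModel X Y) where
  ρ₀ : Measure X
  isProb_ρ₀ : IsProbabilityMeasure ρ₀
  init_ac : S.init ≪ ρ₀
  ϑ : ℕ → X → ℝ≥0
  measurable_ϑ : ∀ t, Measurable (ϑ t)
  q : ℕ → X → X → ℝ≥0
  measurable_q : ∀ t, Measurable (Function.uncurry (q t))
  lintegral_q : ∀ t x, ∫⁻ x', (q t x x' : ℝ≥0∞) ∂S.ν = 1

/-- The oscillation `sup_{x, x'} |h x - h x'|` of a bounded function. -/
noncomputable def osc {E : Type*} (h : E → ℝ) : ℝ :=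
  ⨆ p : E × E, |h p.1 - h p.2|

/-- Conditionally on the σ-algebra `F`, on the event `G` (an element of `F`), the variables
`Z i` are independent with common random law `κ`. Nothing is required outside `G`. -/
def CondIIDOn {Ω E ι : Type*} [Fintype ι] [MeasurableSpace Ω] [MeasurableSpace E]
    (P : Measure Ω) (F : MeasurableSpace Ω) (G : Set Ω) (Z : ι → Ω → E) (κ : Ω → Measure E) :
    Prop :=
  ∀ A : Set Ω, MeasurableSet[F] A → A ⊆ G →
    ∀ B : ι → Set E, (∀ i, MeasurableSet (B i)) →
      P (A ∩ {ω | ∀ i, Z i ω ∈ B i}) = ∫⁻ ω in A, ∏ i, κ ω (B i) ∂P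

namespace StateSpaceModel

variable {X Y : Type*} [MeasurableSpace X] [MeasurableSpace Y]

/-- The unnormalised joint smoothing distribution on paths `x_{0:T}`,
`init(dx₀) ∏_{u=1}^T g_{u-1}(x_{u-1}) M(x_{u-1}, dx_u) g_T(x_T)`, where `g_t = g(·, y_t)`
and `M(x, dx') = m(x, x') ν(dx')`. -/
noncomputable def unnormSmoothing (S : StateSpaceModel X Y) (y : ℕ → Y) (T : ℕ) :
    Measure (Fin (T + 1) → X) :=
  (Measure.pi (Fin.cons S.init (fun _ : Fin T => S.ν))).withDensity
    (fun x => (∏ u : Fin T, (S.m (x u.castSucc) (x u.succ) : ℝ≥0∞)) *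
      ∏ t : Fin (T + 1), (S.g (x t) (y t) : ℝ≥0∞))

/-- The integral `φ_{0:T|T}(h)` of `h` under the joint smoothing distribution. -/
noncomputable def smoothing (S : StateSpaceModel X Y) (y : ℕ → Y) (T : ℕ)
    (h : (Fin (T + 1) → X) → ℝ) : ℝ :=
  (∫ x, h x ∂(S.unnormSmoothing y T)) / (∫ _x, (1 : ℝ) ∂(S.unnormSmoothing y T))

/-- `g_t > 0` for all `t ≤ T`, and `sup_{t ≤ T} |g_t|_∞ < ∞`. -/
def LikelihoodBounded (S : StateSpaceModel X Y) (y : ℕ → Y) (T : ℕ) : Prop :=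
  (∀ t ≤ T, ∀ x, 0 < S.g x (y t)) ∧ ∃ K : ℝ≥0, ∀ t ≤ T, ∀ x, S.g x (y t) ≤ K

end StateSpaceModel

namespace AuxiliaryProposal

variable {X Y : Type*} [MeasurableSpace X] [MeasurableSpace Y] {S : StateSpaceModel X Y}

/-- The initial importance weight function `(d init / d ρ₀)(x) g_0(x)`. -/
noncomputable def weightFun₀ (Q : AuxiliaryProposal S) (y : ℕ → Y) (x : X) : ℝ≥0∞ :=
  S.init.rnDeriv Q.ρ₀ x * S.g x (y 0)

/-- The importance weight function `m(x, x') g_t(x') / (ϑ_t(x) q_t(x, x'))`, `t ≥ 1`. In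
`ℝ≥0∞` a positive number divided by `0` is `∞`, and `0 / 0 = 0`; so boundedness of this function
contains the requirement that the denominator be positive wherever the numerator is. -/
noncomputable def weightFun (Q : AuxiliaryProposal S) (y : ℕ → Y) (t : ℕ) (x x' : X) : ℝ≥0∞ :=
  ((S.m x x' : ℝ≥0∞) * S.g x' (y t)) / ((Q.ϑ t x : ℝ≥0∞) * Q.q t x x')

/-- `sup_{1 ≤ t ≤ T} |ϑ_t|_∞ < ∞` and `sup_{0 ≤ t ≤ T} |ω_t|_∞ < ∞` (the function `ω_0`, which
involves a Radon–Nikodym derivative, being defined up to `ρ₀`-null sets). -/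
def WeightsBounded (Q : AuxiliaryProposal S) (y : ℕ → Y) (T : ℕ) : Prop :=
  (∃ K : ℝ≥0, ∀ t, 1 ≤ t → t ≤ T → ∀ x, Q.ϑ t x ≤ K) ∧
  ∃ K : ℝ≥0, (∀ᵐ x ∂Q.ρ₀, Q.weightFun₀ y x ≤ K) ∧
    ∀ t, 1 ≤ t → t ≤ T → ∀ x x', Q.weightFun y t x x' ≤ K

variable {Ω : Type*} {N : ℕ}

/-- The importance weight `ω_t^i` of the particle `ξ_t^i`; for `t ≥ 1` its ancestor at time
`t - 1` has the index `I_t^i`. -/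
noncomputable def weight (Q : AuxiliaryProposal S) (y : ℕ → Y)
    (ξ : ℕ → Fin N → Ω → X) (I : ℕ → Fin N → Ω → Fin N) : ℕ → Fin N → Ω → ℝ≥0∞
  | 0, i, ω => Q.weightFun₀ y (ξ 0 i ω)
  | t + 1, i, ω => Q.weightFun y (t + 1) (ξ t (I (t + 1) i ω) ω) (ξ (t + 1) i ω)

/-- The σ-algebra generated by the particles and the importance weights up to time `t` (the
observations are fixed). -/
@[reducible] noncomputable def history (Q : AuxiliaryProposal S) (y : ℕ → Y)
    (ξ : ℕ → Fin N → Ω → X) (I : ℕ → Fin N → Ω → Fin N) (t : ℕ) : MeasurableSpace Ω :=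
  ⨆ (s : ℕ) (_ : s ≤ t) (i : Fin N),
    MeasurableSpace.comap (fun ω => (ξ s i ω, Q.weight y ξ I s i ω)) inferInstance

/-- The event that the weights `ω_s^1, …, ω_s^N` have a nonzero sum for all `s ≤ t`. -/
def nondegenerate (Q : AuxiliaryProposal S) (y : ℕ → Y)
    (ξ : ℕ → Fin N → Ω → X) (I : ℕ → Fin N → Ω → Fin N) (t : ℕ) : Set Ω :=
  {ω | ∀ s ≤ t, ∑ i, Q.weight y ξ I s i ω ≠ 0}

/-- The instrumental distribution on `{1, …, N} × X` of the pairs (index, particle) at time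
`t + 1`: the probability measure proportional to `ω_t^i ϑ_{t+1}(ξ_t^i) q_{t+1}(ξ_t^i, x') ν(dx')`. -/
noncomputable def instrumental (Q : AuxiliaryProposal S) (y : ℕ → Y)
    (ξ : ℕ → Fin N → Ω → X) (I : ℕ → Fin N → Ω → Fin N) (t : ℕ) (ω : Ω) :
    Measure (Fin N × X) :=
  ∑ i, ((Q.weight y ξ I t i ω * Q.ϑ (t + 1) (ξ t i ω)) /
      ∑ l, Q.weight y ξ I t l ω * Q.ϑ (t + 1) (ξ t l ω)) •
    (Measure.dirac i).prod
      (S.ν.withDensity (fun x' => (Q.q (t + 1) (ξ t i ω) x' : ℝ≥0∞)))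

/-- The backward transition matrix
`Λ_t(i, j) = ω_t^j m(ξ_t^j, ξ_{t+1}^i) / ∑_l ω_t^l m(ξ_t^l, ξ_{t+1}^i)`. -/
noncomputable def backwardMatrix (Q : AuxiliaryProposal S) (y : ℕ → Y)
    (ξ : ℕ → Fin N → Ω → X) (I : ℕ → Fin N → Ω → Fin N) (t : ℕ) (ω : Ω) (i j : Fin N) : ℝ≥0∞ :=
  (Q.weight y ξ I t j ω * S.m (ξ t j ω) (ξ (t + 1) i ω)) /
    ∑ l, Q.weight y ξ I t l ω * S.m (ξ t l ω) (ξ (t + 1) i ω)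

/-- The law of the backward index path `J_{0:T}` given the particles and weights: `J_T` has
probabilities proportional to the weights `ω_T^i`, and then `J_t` is drawn from
`Λ_t(J_{t+1}, ·)`. -/
noncomputable def backwardPathLaw (Q : AuxiliaryProposal S) (y : ℕ → Y)
    (ξ : ℕ → Fin N → Ω → X) (I : ℕ → Fin N → Ω → Fin N) (T : ℕ) (ω : Ω) :
    Measure (Fin (T + 1) → Fin N) :=
  ∑ j : Fin (T + 1) → Fin N,
    ((Q.weight y ξ I T (j (Fin.last T)) ω / ∑ l, Q.weight y ξ I T l ω) *
      ∏ t : Fin T, Q.backwardMatrix y ξ I t ω (j t.succ) (j t.castSucc)) • Measure.dirac j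

/-- The random variables produced by the forward filtering backward simulation algorithm with
`N` particles and `N` backward index paths up to the horizon `T`. On the event that all particle
weights vanish at some time the algorithm is not defined, and the variables produced from then on
are left arbitrary. -/
structure IsFFBSi (Q : AuxiliaryProposal S) (y : ℕ → Y) (T : ℕ) [MeasurableSpace Ω]
    (P : Measure Ω) (ξ : ℕ → Fin N → Ω → X) (I : ℕ → Fin N → Ω → Fin N)
    (J : Fin N → Ω → (Fin (T + 1) → Fin N)) : Prop where
  measurable_ξ : ∀ t ≤ T, ∀ i, Measurable (ξ t i)
  measurable_I : ∀ t, 1 ≤ t → t ≤ T → ∀ i, Measurable (I t i)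
  measurable_J : ∀ l, Measurable (J l)
  /-- The initial particles are i.i.d. with law `ρ₀`. -/
  initial_indep : iIndepFun (ξ 0) P
  initial_law : ∀ i, P.map (ξ 0 i) = Q.ρ₀
  /-- Given the past, the pairs `(I_{t+1}^i, ξ_{t+1}^i)` are i.i.d. draws from the instrumental
  distribution. -/
  forward : ∀ t < T, CondIIDOn P (Q.history y ξ I t) (Q.nondegenerate y ξ I t)
    (fun i ω => (I (t + 1) i ω, ξ (t + 1) i ω)) (Q.instrumental y ξ I t)
  /-- Given the particles and weights, the backward index paths are i.i.d. -/
  backward : CondIIDOn P (Q.history y ξ I T) (Q.nondegenerate y ξ I T) J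
    (Q.backwardPathLaw y ξ I T)

end AuxiliaryProposal

/-- The FFBSi estimator `N⁻¹ ∑_l h(ξ_0^{J_0^l}, …, ξ_T^{J_T^l})`. -/
noncomputable def ffbsiEstimator {X Ω : Type*} {N T : ℕ} (ξ : ℕ → Fin N → Ω → X)
    (J : Fin N → Ω → (Fin (T + 1) → Fin N)) (h : (Fin (T + 1) → X) → ℝ) (ω : Ω) : ℝ :=
  (N : ℝ)⁻¹ * ∑ l, h (fun t => ξ t (J l ω t) ω)

/-! Given the particles, the backward paths are i.i.d., so the FFBSi estimator is within `δ` of its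
conditional mean by a conditional Hoeffding inequality. That conditional mean is the forward
filtering backward smoothing estimate `estimate`, and it remains to show by induction on the time
`t` that it concentrates around the smoothing distribution of `x_{0:t}`, uniformly over bounded test
functions (`exists_deviation_bound`).

The estimate at time `t + 1` is a ratio `A / B` of empirical means of weight times backward mean,
for `f` and for `1`. The backward mean of a new particle depends on its position and on the past
only, not on its ancestor, so given the past the summands are i.i.d. and bounded. Their conditional
mean is computable (`integral_instrumental`): the importance weight cancels the multiplier and the
proposal density, the denominator of the backward probabilities cancels the mixture `∑ W_l m(ξ_l,
x)`, and what is left is a random factor `1 / τ` times the time-`t` estimate of `pathStep f`. The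
induction hypothesis replaces this estimate by the exact value, which is a constant `β > 0` times
the smoothing integral of `f` (`smoothing_pathStep`). The factor `τ` is common to numerator and
denominator and at most the bound on the multipliers, so it disappears from the ratio; this is the
deterministic `abs_div_sub_lt_of_close`, which also yields `B > 0`, that is, non-degeneracy at time
`t + 1`.

Two degeneracies need care. Weights may all vanish, so the induction bounds the probability of
degeneracy together with that of a large error. A row of the backward matrix may be `0 / 0`;
`reweight` replaces it by a probability vector, and a comparison of total masses shows that almost
surely the path law is unchanged. -/

/-! ### Hoeffding inequalities for i.i.d. and conditionally i.i.d. samples. -/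

/-- By Hoeffding's lemma a centred variable with values in an interval of length `2 * M` is
sub-Gaussian with parameter `M ^ 2`; independence adds the parameters up to `N * M ^ 2`. -/
theorem measureReal_pi_sum_sub_integral_ge_le {E : Type*} [MeasurableSpace E] {N : ℕ}
    (κ : Measure E) [IsProbabilityMeasure κ] {f : E → ℝ} (hf : Measurable f) {M : ℝ} (hM : 0 < M)
    (hfM : ∀ z, |f z| ≤ M) {δ : ℝ} (hδ : 0 ≤ δ) :
    (Measure.pi (fun _ : Fin N => κ)).real {z | N * δ ≤ ∑ i, (f (z i) - ∫ x, f x ∂κ)}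
      ≤ Real.exp (-(N * δ ^ 2 / (2 * M ^ 2))) := by
  have hsub : HasSubgaussianMGF (fun x => f x - ∫ x, f x ∂κ) ((‖M - (-M)‖₊ / 2) ^ 2) κ :=
    hasSubgaussianMGF_of_mem_Icc hf.aemeasurable
      (ae_of_all _ fun z => Set.mem_Icc.2 (abs_le.1 (hfM z)))
  have hind : iIndepFun (fun (i : Fin N) (z : Fin N → E) => f (z i) - ∫ x, f x ∂κ)
      (Measure.pi (fun _ : Fin N => κ)) :=
    iIndepFun_pi (X := fun _ x => f x - ∫ x, f x ∂κ)
      (fun _ => (hf.sub_const _).aemeasurable)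
  have hsub' : ∀ i : Fin N, HasSubgaussianMGF (fun z : Fin N → E => f (z i) - ∫ x, f x ∂κ)
      ((‖M - (-M)‖₊ / 2) ^ 2) (Measure.pi (fun _ : Fin N => κ)) := by
    intro i
    refine HasSubgaussianMGF.of_map (Y := fun z : Fin N → E => z i)
      (X := fun x => f x - ∫ x, f x ∂κ) (measurable_pi_apply i).aemeasurable ?_
    rw [(measurePreserving_eval (fun _ : Fin N => κ) i).map_eq]
    exact hsub
  have h := HasSubgaussianMGF.measure_sum_ge_le_of_iIndepFun hind
    (s := Finset.univ) (fun i _ => hsub' i) (ε := N * δ) (by positivity)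
  refine h.trans (Real.exp_le_exp.2 (le_of_eq ?_))
  have : ‖M - (-M)‖ = 2 * M := by
    rw [sub_neg_eq_add, ← two_mul, Real.norm_eq_abs, abs_of_pos (by positivity)]
  rcases Nat.eq_zero_or_pos N with rfl | hN
  · simp
  · have hN' : (0 : ℝ) < N := by exact_mod_cast hN
    push_cast
    rw [this]
    simp only [Finset.sum_const, Finset.card_univ, Fintype.card_fin, nsmul_eq_mul]
    field_simp

/-- Hoeffding's inequality for the empirical mean of a bounded function of an i.i.d. sample. -/
theorem measure_pi_abs_mean_sub_integral_ge_le {E : Type*} [MeasurableSpace E] {N : ℕ} (hN : 0 < N)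
    (κ : Measure E) [IsProbabilityMeasure κ] {f : E → ℝ} (hf : Measurable f) {M : ℝ} (hM : 0 < M)
    (hfM : ∀ z, |f z| ≤ M) {δ : ℝ} (hδ : 0 ≤ δ) :
    Measure.pi (fun _ : Fin N => κ) {z | δ ≤ |(N : ℝ)⁻¹ * ∑ i, f (z i) - ∫ x, f x ∂κ|}
      ≤ ENNReal.ofReal (2 * Real.exp (-(N * δ ^ 2 / (2 * M ^ 2)))) := by
  rw [← ofReal_measureReal]
  apply ENNReal.ofReal_le_ofReal
  have h1 := measureReal_pi_sum_sub_integral_ge_le (N := N) κ hf hM hfM hδ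
  have h2 := measureReal_pi_sum_sub_integral_ge_le (N := N) κ hf.neg hM
    (fun z => by simpa using hfM z) hδ
  have hN' : (0 : ℝ) < N := by exact_mod_cast hN
  calc _ ≤ (Measure.pi (fun _ : Fin N => κ)).real
        ({z | N * δ ≤ ∑ i, (f (z i) - ∫ x, f x ∂κ)} ∪
          {z | N * δ ≤ ∑ i, ((-f) (z i) - ∫ x, (-f) x ∂κ)}) := by
        refine measureReal_mono fun z hz => ?_
        simp only [Set.mem_ofPred_eq, Set.mem_union, Pi.neg_apply, integral_neg,
          Finset.sum_sub_distrib, Finset.sum_const, Finset.card_univ, Fintype.card_fin,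
          nsmul_eq_mul, Finset.sum_neg_distrib] at hz ⊢
        have e : (N : ℝ)⁻¹ * ∑ i, f (z i) - ∫ x, f x ∂κ
            = (N : ℝ)⁻¹ * (∑ i, f (z i) - N * ∫ x, f x ∂κ) := by field_simp
        rw [e, abs_mul, abs_of_pos (inv_pos.2 hN'), ← div_eq_inv_mul, le_div_iff₀ hN', mul_comm,
          le_abs] at hz
        rcases hz with hz | hz
        · exact Or.inl hz
        · right; linarith
    _ ≤ _ := (measureReal_union_le _ _).trans (by linarith)

/-- If conditionally on `H` the variables `Z i` are i.i.d. with law `κ H` on the event `H ∈ G`,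
a bound for the product measures `(κ s)^ι` of the sections of `D` bounds the probability of
`(H, Z) ∈ D`. -/
theorem measure_prodMk_mem_le_of_pi_le {Ω S E ι : Type*} [Fintype ι] [MeasurableSpace Ω]
    [MeasurableSpace S] [MeasurableSpace E] (P : Measure Ω) [IsProbabilityMeasure P]
    {H : Ω → S} (hH : Measurable H) {G : Set S} (hG : MeasurableSet G)
    {Z : ι → Ω → E} (hZ : ∀ i, Measurable (Z i)) {κ : S → Measure E}
    (hκ : ∀ B, MeasurableSet B → Measurable fun s => κ s B)
    (hκ1 : ∀ s ∈ G, κ s Set.univ = 1)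
    (hcond : ∀ A : Set S, MeasurableSet A → A ⊆ G → ∀ B : ι → Set E, (∀ i, MeasurableSet (B i)) →
      P (H ⁻¹' A ∩ {ω | ∀ i, Z i ω ∈ B i}) = ∫⁻ ω in H ⁻¹' A, ∏ i, κ (H ω) (B i) ∂P)
    {D : Set (S × (ι → E))} (hD : MeasurableSet D) {b : ℝ≥0∞}
    (hb : ∀ s ∈ G, Measure.pi (fun _ : ι => κ s) {z | (s, z) ∈ D} ≤ b) :
    P (H ⁻¹' G ∩ {ω | (H ω, fun i => Z i ω) ∈ D}) ≤ b := by
  classical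
  -- Nothing bounds `κ` outside `G`; setting it to zero there makes the family of product measures a
  -- finite kernel.
  let κ' : S → Measure E := fun s => if s ∈ G then κ s else 0
  have hκ'u : ∀ s, κ' s Set.univ ≤ 1 := by
    intro s
    by_cases hs : s ∈ G
    · simp [κ', hs, hκ1 s hs]
    · simp [κ', hs]
  have hfin : ∀ s, IsFiniteMeasure (κ' s) := fun s => ⟨(hκ'u s).trans_lt ENNReal.one_lt_top⟩
  have hκ'm : ∀ B, MeasurableSet B → Measurable fun s => κ' s B := by
    intro B hB
    have : (fun s => κ' s B) = fun s => if s ∈ G then κ s B else 0 := by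
      ext s; by_cases hs : s ∈ G <;> simp [κ', hs]
    rw [this]
    exact Measurable.ite hG (hκ B hB) measurable_const
  have hpim : Measurable fun s => Measure.pi (fun _ : ι => κ' s) := by
    refine Measurable.measure_of_isPiSystem generateFrom_pi.symm isPiSystem_pi ?_ ?_
    · rintro _ ⟨B, hB, rfl⟩
      simp only [Set.mem_pi, Set.mem_univ, forall_true_left, Set.mem_ofPred_eq] at hB
      simp only [Measure.pi_pi]
      exact Finset.measurable_prod _ fun i _ => hκ'm _ (hB i)
    · simp only [Measure.pi_univ]
      exact Finset.measurable_prod _ fun i _ => hκ'm _ MeasurableSet.univ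
  let K : Kernel S (ι → E) := ⟨fun s => Measure.pi (fun _ : ι => κ' s), hpim⟩
  have hK : ∀ s, K s = Measure.pi (fun _ : ι => κ' s) := fun s => rfl
  have hKfin : IsFiniteKernel K := by
    refine ⟨1, ENNReal.one_lt_top, fun s => ?_⟩
    rw [hK, Measure.pi_univ]
    exact Finset.prod_le_one' fun i _ => hκ'u s
  have hZm : Measurable fun ω => (fun i => Z i ω) := measurable_pi_iff.2 hZ
  have hHG : MeasurableSet (H ⁻¹' G) := hH hG
  -- The hypothesis on rectangles identifies the joint law of `(H, Z)` on the event by a π-system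
  -- argument; sections of arbitrary measurable sets are then available through `compProd`.
  have key : (P.restrict (H ⁻¹' G)).map (fun ω => (H ω, fun i => Z i ω))
      = ((P.restrict (H ⁻¹' G)).map H) ⊗ₘ K := by
    have hrect : ∀ (A : Set S), MeasurableSet A → ∀ B : ι → Set E, (∀ i, MeasurableSet (B i)) →
        (P.restrict (H ⁻¹' G)).map (fun ω => (H ω, fun i => Z i ω)) (A ×ˢ Set.univ.pi B)
        = (((P.restrict (H ⁻¹' G)).map H) ⊗ₘ K) (A ×ˢ Set.univ.pi B) := by
      intro A hA B hB
      have hBm : MeasurableSet (Set.univ.pi B) := MeasurableSet.univ_pi hB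
      rw [Measure.map_apply (hH.prodMk hZm) (hA.prod hBm),
        Measure.compProd_apply_prod hA hBm, Measure.restrict_apply
          ((hH.prodMk hZm) (hA.prod hBm)), setLIntegral_map hA (K.measurable_coe hBm) hH,
        Measure.restrict_restrict (hH hA), ← Set.preimage_inter]
      have := hcond (A ∩ G) (hA.inter hG) Set.inter_subset_right B hB
      have e : (fun ω => (H ω, fun i => Z i ω)) ⁻¹' A ×ˢ Set.univ.pi B ∩ H ⁻¹' G
          = H ⁻¹' (A ∩ G) ∩ {ω | ∀ i, Z i ω ∈ B i} := by
        ext ω; simp; tauto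
      rw [e, this]
      refine setLIntegral_congr_fun (hH (hA.inter hG)) fun ω hω => ?_
      have hω' : H ω ∈ G := hω.2
      have hfin' := hfin (H ω)
      simp only [κ', hω', if_true] at hfin'
      simp [hK, κ', hω', Measure.pi_pi]
    refine ext_of_generate_finite
      (Set.image2 (· ×ˢ ·) {A : Set S | MeasurableSet A}
        (Set.univ.pi '' Set.univ.pi fun _ : ι => {B : Set E | MeasurableSet B}))
      ?_ (MeasurableSpace.isPiSystem_measurableSet.prod isPiSystem_pi) ?_ ?_
    · refine (generateFrom_eq_prod MeasurableSpace.generateFrom_measurableSet generateFrom_pi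
        isCountablySpanning_measurableSet ?_).symm
      exact ⟨fun _ => Set.univ, fun _ => ⟨fun _ => Set.univ, by simp, by simp⟩, Set.iUnion_const _⟩
    · rintro _ ⟨A, hA, _, ⟨B, hB, rfl⟩, rfl⟩
      exact hrect A hA B (by simpa using hB)
    · simpa using hrect Set.univ MeasurableSet.univ (fun _ => Set.univ) (by simp)
  have h1 : P (H ⁻¹' G ∩ {ω | (H ω, fun i => Z i ω) ∈ D})
      = (P.restrict (H ⁻¹' G)).map (fun ω => (H ω, fun i => Z i ω)) D := by
    rw [Measure.map_apply (hH.prodMk hZm) hD, Measure.restrict_apply ((hH.prodMk hZm) hD),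
      Set.inter_comm]
    rfl
  rw [h1, key, Measure.compProd_apply hD, lintegral_map (by
    exact Kernel.measurable_kernel_prodMk_left hD) hH]
  calc _ ≤ ∫⁻ ω in H ⁻¹' G, b ∂P := by
        refine setLIntegral_mono' hHG fun ω hω => ?_
        have hω' : H ω ∈ G := hω
        have := hb _ hω'
        rw [hK]
        simp only [κ', hω', if_true]
        exact this
    _ ≤ b := by
        rw [setLIntegral_const]
        exact mul_le_of_le_one_right' prob_le_one

/-- The random law in `CondIIDOn` has total mass one almost surely on `G`. -/
theorem CondIIDOn.ae_mass_eq_one {Ω E ι : Type*} [Fintype ι] [Nonempty ι]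
    {F : MeasurableSpace Ω} [mΩ : MeasurableSpace Ω]
    [MeasurableSpace E] {P : Measure Ω} [IsProbabilityMeasure P]
    (hF : F ≤ mΩ) {G : Set Ω} (hG : MeasurableSet[F] G) {Z : ι → Ω → E} {κ : Ω → Measure E}
    (hκ : Measurable[F] fun ω => κ ω Set.univ) (hκ1 : ∀ ω ∈ G, κ ω Set.univ ≤ 1)
    (h : CondIIDOn P F G Z κ) : P {ω | ω ∈ G ∧ κ ω Set.univ ≠ 1} = 0 := by
  have hA : MeasurableSet[F] (G ∩ {ω | κ ω Set.univ ≠ 1}) :=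
    hG.inter ((hκ (measurableSet_singleton 1)).compl)
  -- With all `B i = univ` the hypothesis says that `P A` is the integral over `A` of a power of the
  -- mass. On `A` the mass is below one, and the power is positive because `ι` is nonempty, so `P A`
  -- must be zero.
  have h1 := h _ hA Set.inter_subset_left (fun _ => Set.univ) (fun _ => MeasurableSet.univ)
  simp only [Set.mem_univ, implies_true, Set.ofPred_true, Set.inter_univ, Finset.prod_const] at h1
  set A := G ∩ {ω | κ ω Set.univ ≠ 1} with hAdef
  have hA' : MeasurableSet A := hF _ hA
  change P A = 0
  have h2 : ∫⁻ ω in A, (1 - κ ω Set.univ ^ Finset.univ.card (α := ι)) ∂P = 0 := by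
    have hle : ∀ ω ∈ A, κ ω Set.univ ^ (Finset.univ : Finset ι).card ≤ 1 := fun ω hω =>
      pow_le_one₀ zero_le (hκ1 ω hω.1)
    rw [lintegral_sub' ((hκ.mono hF le_rfl).pow_const _).aemeasurable]
    · rw [← h1]; simp
    · rw [← h1]; exact measure_ne_top _ _
    · exact (ae_restrict_iff' hA').2 (ae_of_all _ hle)
  by_contra hne
  have h3 := (setLIntegral_pos_iff (μ := P) (s := A)
    (f := fun ω => 1 - κ ω Set.univ ^ Finset.univ.card (α := ι))
    (measurable_const.sub ((hκ.mono hF le_rfl).pow_const _))).2 ?_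
  · exact h3.ne' h2
  · refine (pos_iff_ne_zero.2 hne).trans_le (measure_mono fun ω hω => ⟨?_, hω⟩)
    have hlt : κ ω Set.univ < 1 := lt_of_le_of_ne (hκ1 ω hω.1) hω.2
    have : κ ω Set.univ ^ (Finset.univ : Finset ι).card < 1 :=
      pow_lt_one₀ zero_le hlt (Finset.card_pos.2 Finset.univ_nonempty).ne'
    simpa [Function.mem_support, tsub_eq_zero_iff_le] using this

/-- Conditional Hoeffding inequality. -/
theorem CondIIDOn.measure_abs_mean_sub_integral_ge_le {Ω E : Type*} {N : ℕ} (hN : 0 < N)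
    {F : MeasurableSpace Ω} [mΩ : MeasurableSpace Ω]
    [mE : MeasurableSpace E] {P : Measure Ω} [IsProbabilityMeasure P]
    (hF : F ≤ mΩ) {G : Set Ω} (hG : MeasurableSet[F] G) {Z : Fin N → Ω → E} {κ : Ω → Measure E}
    (hZ : ∀ i, Measurable (Z i))
    (hκ : ∀ B, MeasurableSet B → Measurable[F] fun ω => κ ω B) (hκ1 : ∀ ω ∈ G, κ ω Set.univ = 1)
    (h : CondIIDOn P F G Z κ) {f : Ω → E → ℝ}
    (hf : Measurable[F.prod mE] (Function.uncurry f)) {a : Ω → ℝ} (ha : Measurable[F] a)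
    {M : ℝ} (hM : 0 < M) (hfM : ∀ ω ∈ G, ∀ z, |f ω z| ≤ M)
    (hfa : ∀ ω ∈ G, ∫ z, f ω z ∂κ ω = a ω) {δ : ℝ} (hδ : 0 ≤ δ) :
    P {ω | ω ∈ G ∧ δ ≤ |(N : ℝ)⁻¹ * ∑ i, f ω (Z i ω) - a ω|}
      ≤ ENNReal.ofReal (2 * Real.exp (-(N * δ ^ 2 / (2 * M ^ 2)))) := by
  let D : Set (Ω × (Fin N → E)) := {p | δ ≤ |(N : ℝ)⁻¹ * ∑ i, f p.1 (p.2 i) - a p.1|}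
  have hD : MeasurableSet[F.prod MeasurableSpace.pi] D := by
    have h1 : ∀ i : Fin N, @Measurable _ _ (F.prod MeasurableSpace.pi) _
        (fun p : Ω × (Fin N → E) => f p.1 (p.2 i)) := by
      intro i
      exact hf.comp ((@measurable_fst Ω (Fin N → E) F _).prodMk
        ((measurable_pi_apply i).comp (@measurable_snd Ω (Fin N → E) F _)))
    have h2 : @Measurable _ _ (F.prod MeasurableSpace.pi) _
        (fun p : Ω × (Fin N → E) => a p.1) := ha.comp (@measurable_fst Ω (Fin N → E) F _)
    exact (continuous_abs.measurable.comp
      (((Finset.measurable_sum _ fun i _ => h1 i).const_mul _).sub h2)) measurableSet_Ici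
  -- The conditioning variable is the identity map from `Ω` to `Ω` with the smaller σ-algebra `F`.
  have := @measure_prodMk_mem_le_of_pi_le Ω Ω E (Fin N) _ mΩ F mE P _ id (measurable_id'' hF)
    G hG Z hZ κ hκ hκ1 (fun A hA hAG B hB => h A hA hAG B hB) D hD
    (ENNReal.ofReal (2 * Real.exp (-(N * δ ^ 2 / (2 * M ^ 2))))) ?_
  · exact this
  · intro ω hω
    have : IsProbabilityMeasure (κ ω) := ⟨hκ1 ω hω⟩
    have hfω : Measurable (f ω) := hf.comp (@measurable_prodMk_left Ω E F mE ω)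
    have := measure_pi_abs_mean_sub_integral_ge_le hN (κ ω) hfω hM (hfM ω hω) hδ
    rw [hfa ω hω] at this
    exact this

/-! ### The unnormalised smoothing measures and their one-step recursion. -/

theorem Fin.measurable_snoc {X : Type*} [MeasurableSpace X] (t : ℕ) :
    Measurable fun q : (Fin (t + 1) → X) × X => (Fin.snoc q.1 q.2 : Fin (t + 2) → X) := by
  refine measurable_pi_iff.2 fun i => ?_
  refine Fin.lastCases ?_ (fun j => ?_) i
  · simpa using measurable_snd
  · simp only [Fin.snoc_castSucc]
    exact (measurable_pi_apply j).comp measurable_fst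

namespace StateSpaceModel

variable {X Y : Type*} [MeasurableSpace X] [MeasurableSpace Y] (S : StateSpaceModel X Y)
  (y : ℕ → Y)

/-- The one-step extension of a function on paths `x_{0:t+1}` to a function on paths `x_{0:t}`:
`f` is integrated against `m(x_t, x) g_{t+1}(x) ν(dx)` in its last coordinate. -/
noncomputable def pathStep (t : ℕ) (f : (Fin (t + 2) → X) → ℝ) (p : Fin (t + 1) → X) : ℝ :=
  ∫ x, (S.m (p (Fin.last t)) x : ℝ) * S.g x (y (t + 1)) * f (Fin.snoc p x) ∂S.ν

theorem measurable_g_right (z : Y) : Measurable fun x => S.g x z :=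
  S.measurable_g.comp measurable_prodMk_right

theorem measurable_m_right (x : X) : Measurable fun x' => S.m x x' :=
  S.measurable_m.comp measurable_prodMk_left

theorem measurable_m_comp {Z : Type*} [MeasurableSpace Z] {a b : Z → X} (ha : Measurable a)
    (hb : Measurable b) : Measurable fun z => S.m (a z) (b z) :=
  S.measurable_m.comp (ha.prodMk hb)

theorem measurePreserving_snoc (t : ℕ) :
    MeasurePreserving (fun q : (Fin (t + 1) → X) × X => (Fin.snoc q.1 q.2 : Fin (t + 2) → X))
      ((Measure.pi (Fin.cons S.init (fun _ : Fin t => S.ν))).prod S.ν)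
      (Measure.pi (Fin.cons S.init (fun _ : Fin (t + 1) => S.ν))) := by
  have := S.isProb_init
  have := S.sigmaFinite_ν
  have hsf : ∀ n, ∀ i, SigmaFinite
      ((Fin.cons S.init (fun _ : Fin n => S.ν) : Fin (n + 1) → Measure X) i) := by
    intro n i
    refine Fin.cases ?_ (fun j => ?_) i
    · simpa using (inferInstance : SigmaFinite S.init)
    · simpa using (inferInstance : SigmaFinite S.ν)
  have := hsf t
  have := hsf (t + 1)
  have h1 := (measurePreserving_piFinSuccAbove
    (Fin.cons S.init (fun _ : Fin (t + 1) => S.ν) : Fin (t + 2) → Measure X) (Fin.last _)).symm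
  have e1 : (Fin.cons S.init (fun _ : Fin (t + 1) => S.ν) : Fin (t + 2) → Measure X)
      (Fin.last _) = S.ν := by
    rw [← Fin.succ_last, Fin.cons_succ]
  have e2 : (fun j => (Fin.cons S.init (fun _ : Fin (t + 1) => S.ν) : Fin (t + 2) → Measure X)
      ((Fin.last _).succAbove j)) = Fin.cons S.init (fun _ : Fin t => S.ν) := by
    funext j
    rw [Fin.succAbove_last]
    refine Fin.cases ?_ (fun k => ?_) j
    · simp
    · rw [← Fin.succ_castSucc, Fin.cons_succ, Fin.cons_succ]
  rw [e1, e2] at h1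
  -- `piFinSuccAbove` lists the separated coordinate first, here the last time, whereas paths are
  -- extended on the right.
  have hsw := Measure.measurePreserving_swap
    (μ := Measure.pi (Fin.cons S.init (fun _ : Fin t => S.ν) : Fin (t + 1) → Measure X)) (ν := S.ν)
  have h2 := h1.comp hsw
  convert h2 using 1
  funext q
  simp only [Function.comp_apply, MeasurableEquiv.piFinSuccAbove, MeasurableEquiv.symm_mk,
    MeasurableEquiv.coe_mk, Fin.insertNthEquiv, Equiv.symm_symm, Equiv.coe_fn_mk, Prod.fst_swap,
    Prod.snd_swap]
  exact (Fin.insertNth_last' _ _).symm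

theorem measurable_unnormSmoothing_density (t : ℕ) : Measurable fun x : Fin (t + 1) → X =>
    (∏ u : Fin t, (S.m (x u.castSucc) (x u.succ) : ℝ≥0∞)) *
      ∏ s : Fin (t + 1), (S.g (x s) (y s) : ℝ≥0∞) := by
  refine (Finset.measurable_prod _ fun u _ => ?_).mul (Finset.measurable_prod _ fun s _ => ?_)
  · exact measurable_coe_nnreal_ennreal.comp 
      (S.measurable_m_comp (measurable_pi_apply _) (measurable_pi_apply _))
  · exact measurable_coe_nnreal_ennreal.comp ((S.measurable_g_right _).comp
      (measurable_pi_apply _))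

theorem measurable_step_density (t : ℕ) : Measurable fun q : (Fin (t + 1) → X) × X =>
    ((S.m (q.1 (Fin.last t)) q.2 * S.g q.2 (y (t + 1)) : ℝ≥0) : ℝ≥0) :=
  (S.measurable_m_comp ((measurable_pi_apply _).comp measurable_fst) measurable_snd).mul
      ((S.measurable_g_right _).comp measurable_snd)

/-- Both products in the density split off their last factor, and the reference measure splits off a
factor `ν`. This recursion drives every induction on time below. -/
theorem unnormSmoothing_succ (t : ℕ) :
    S.unnormSmoothing y (t + 1) = (((S.unnormSmoothing y t).prod S.ν).withDensity
      (fun q => ((S.m (q.1 (Fin.last t)) q.2 * S.g q.2 (y (t + 1)) : ℝ≥0) : ℝ≥0∞))).map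
        (fun q => (Fin.snoc q.1 q.2 : Fin (t + 2) → X)) := by
  have := S.isProb_init
  have := S.sigmaFinite_ν
  have hsf : ∀ i, SigmaFinite
      ((Fin.cons S.init (fun _ : Fin t => S.ν) : Fin (t + 1) → Measure X) i) := by
    intro i
    refine Fin.cases ?_ (fun j => ?_) i
    · simpa using (inferInstance : SigmaFinite S.init)
    · simpa using (inferInstance : SigmaFinite S.ν)
  have hmp := S.measurePreserving_snoc t
  have hd := S.measurable_unnormSmoothing_density y t
  have hd' := S.measurable_unnormSmoothing_density y (t + 1)
  have hs := (S.measurable_step_density y t).coe_nnreal_ennreal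
  have hw : (S.unnormSmoothing y t).prod S.ν = _ := prod_withDensity_left hd
  have hw2 := (withDensity_mul ((Measure.pi (Fin.cons S.init (fun _ : Fin t => S.ν))).prod S.ν)
    (hd.comp (measurable_fst (β := X))) hs).symm
  rw [hw]
  refine Eq.trans ?_ (congrArg (Measure.map _) hw2).symm
  ext B hB
  rw [Measure.map_apply hmp.measurable hB, withDensity_apply _ (hmp.measurable hB)]
  unfold unnormSmoothing
  rw [withDensity_apply _ hB, ← hmp.map_eq, setLIntegral_map hB hd' hmp.measurable]
  refine setLIntegral_congr_fun (hmp.measurable hB) fun q _ => ?_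
  simp only [Pi.mul_apply, Function.comp_apply, ENNReal.coe_mul]
  rw [Fin.prod_univ_castSucc (n := t), Fin.prod_univ_castSucc (n := t + 1)]
  simp only [Fin.snoc_castSucc, Fin.snoc_last, Fin.succ_castSucc, Fin.succ_last, Fin.val_castSucc,
    Fin.val_last]
  ring

theorem unnormSmoothing_zero :
    S.unnormSmoothing y 0 = (S.init.withDensity fun x => (S.g x (y 0) : ℝ≥0∞)).map
      (fun x (_ : Fin 1) => x) := by
  have := S.isProb_init
  have hm : Measurable fun (x : X) (_ : Fin 1) => x := measurable_pi_iff.2 fun _ => measurable_id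
  have hmp : MeasurePreserving (fun (x : X) (_ : Fin 1) => x) S.init
      (Measure.pi fun _ : Fin (0 + 1) => S.init) := by
    convert (measurePreserving_funUnique S.init (Fin 1)).symm
    rfl
  have e : (Fin.cons S.init (fun _ : Fin 0 => S.ν) : Fin 1 → Measure X) = fun _ => S.init := by
    funext i; fin_cases i; rfl
  ext B hB
  rw [Measure.map_apply hm hB, withDensity_apply _ (hm hB)]
  unfold unnormSmoothing
  rw [withDensity_apply _ hB, e]
  rw [← hmp.map_eq, setLIntegral_map hB (S.measurable_unnormSmoothing_density y 0) hmp.measurable]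
  refine setLIntegral_congr_fun (hmp.measurable hB) fun q _ => ?_
  simp

variable {S y}

theorem lintegral_step_le {K : ℝ≥0} {t : ℕ} (hg : ∀ x, S.g x (y (t + 1)) ≤ K) (x : X) :
    ∫⁻ x', ((S.m x x' * S.g x' (y (t + 1)) : ℝ≥0) : ℝ≥0∞) ∂S.ν ≤ K := by
  calc _ ≤ ∫⁻ x', (S.m x x' : ℝ≥0∞) * K ∂S.ν := by
        refine lintegral_mono fun x' => ?_
        rw [← ENNReal.coe_mul]
        exact ENNReal.coe_le_coe.2 (mul_le_mul_right (hg x') _)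
    _ = K := by
        rw [lintegral_mul_const _ (S.measurable_m_right x).coe_nnreal_ennreal, S.lintegral_m,
          one_mul]

theorem isFiniteMeasure_unnormSmoothing {K : ℝ≥0} {t : ℕ}
    (hg : ∀ s ≤ t, ∀ x, S.g x (y s) ≤ K) : IsFiniteMeasure (S.unnormSmoothing y t) := by
  have := S.isProb_init
  have := S.sigmaFinite_ν
  induction t with
  | zero =>
    have hm : Measurable fun (x : X) (_ : Fin 1) => x := measurable_pi_iff.2 fun _ => measurable_id
    refine ⟨?_⟩
    rw [unnormSmoothing_zero, Measure.map_apply hm MeasurableSet.univ, Set.preimage_univ,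
      withDensity_apply _ MeasurableSet.univ, Measure.restrict_univ]
    refine (lintegral_mono (g := fun _ => (K : ℝ≥0∞))
      fun x => ENNReal.coe_le_coe.2 (hg 0 le_rfl x)).trans_lt ?_
    simp
  | succ t ih =>
    have := ih fun s hs => hg s (by omega)
    refine ⟨?_⟩
    rw [unnormSmoothing_succ, Measure.map_apply (Fin.measurable_snoc t) MeasurableSet.univ,
      Set.preimage_univ, withDensity_apply _ MeasurableSet.univ, Measure.restrict_univ,
      lintegral_prod _ (S.measurable_step_density y t).coe_nnreal_ennreal.aemeasurable]
    refine (lintegral_mono (g := fun _ => (K : ℝ≥0∞))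
      fun p => lintegral_step_le (hg (t + 1) le_rfl) _).trans_lt ?_
    rw [lintegral_const]
    exact ENNReal.mul_lt_top ENNReal.coe_lt_top (measure_lt_top _ _)

/-- As `g > 0`, a vanishing integral would force `m(x, ·) = 0` almost everywhere, although it
integrates to one. -/
theorem lintegral_step_ne_zero {z : Y} (hg : ∀ x, 0 < S.g x z) (x : X) :
    ∫⁻ x', ((S.m x x' * S.g x' z : ℝ≥0) : ℝ≥0∞) ∂S.ν ≠ 0 := by
  intro h
  have hd : Measurable fun x' => S.m x x' * S.g x' z :=
    (S.measurable_m_right x).mul (S.measurable_g_right _)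
  rw [lintegral_eq_zero_iff hd.coe_nnreal_ennreal] at h
  have h2 : (fun x' => (S.m x x' : ℝ≥0∞)) =ᵐ[S.ν] 0 := by
    filter_upwards [h] with x' hx'
    have : S.m x x' * S.g x' z = 0 := by simpa using hx'
    simpa using (mul_eq_zero.1 this).resolve_right (hg x').ne'
  have h3 := lintegral_congr_ae h2
  rw [S.lintegral_m] at h3
  simp at h3

theorem unnormSmoothing_univ_ne_zero {t : ℕ} (hg : ∀ s ≤ t, ∀ x, 0 < S.g x (y s)) :
    S.unnormSmoothing y t Set.univ ≠ 0 := by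
  have := S.isProb_init
  have := S.sigmaFinite_ν
  induction t with
  | zero =>
    have hm : Measurable fun (x : X) (_ : Fin 1) => x := measurable_pi_iff.2 fun _ => measurable_id
    rw [unnormSmoothing_zero, Measure.map_apply hm MeasurableSet.univ, Set.preimage_univ,
      withDensity_apply _ MeasurableSet.univ, Measure.restrict_univ, Ne,
      lintegral_eq_zero_iff (S.measurable_g_right _).coe_nnreal_ennreal]
    intro h
    have : ∀ᵐ x ∂S.init, False := by
      filter_upwards [h] with x hx
      exact (hg 0 le_rfl x).ne' (by simpa using hx)
    simp at this
    exact (IsProbabilityMeasure.ne_zero S.init) this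
  | succ t ih =>
    have h0 := ih fun s hs => hg s (by omega)
    have hd := S.measurable_step_density y t
    rw [unnormSmoothing_succ, Measure.map_apply (Fin.measurable_snoc t) MeasurableSet.univ,
      Set.preimage_univ, withDensity_apply _ MeasurableSet.univ, Measure.restrict_univ,
      lintegral_prod _ hd.coe_nnreal_ennreal.aemeasurable, Ne,
      lintegral_eq_zero_iff hd.coe_nnreal_ennreal.lintegral_prod_right']
    intro h
    have : ∀ᵐ x ∂S.unnormSmoothing y t, False := by
      filter_upwards [h] with p hp
      exact lintegral_step_ne_zero (hg (t + 1) le_rfl) _ hp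
    simp at this
    exact h0 (by simp [this])

/-- Fubini applied to the recursion: the last coordinate is integrated out first, which turns a test
function at time `t + 1` into one at time `t`. -/
theorem integral_unnormSmoothing_succ {K : ℝ≥0} {t : ℕ}
    (hg : ∀ s ≤ t + 1, ∀ x, S.g x (y s) ≤ K) {f : (Fin (t + 2) → X) → ℝ} (hf : Measurable f)
    {M : ℝ} (hfM : ∀ x, |f x| ≤ M) :
    ∫ x, f x ∂S.unnormSmoothing y (t + 1) = ∫ p, S.pathStep y t f p ∂S.unnormSmoothing y t := by
  have := S.sigmaFinite_ν
  have := isFiniteMeasure_unnormSmoothing (S := S) (y := y) (t := t) fun s hs => hg s (by omega)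
  have := isFiniteMeasure_unnormSmoothing hg
  have hd := S.measurable_step_density y t
  have hsn := Fin.measurable_snoc (X := X) t
  have hint : Integrable f (S.unnormSmoothing y (t + 1)) :=
    Integrable.of_bound hf.aestronglyMeasurable M (ae_of_all _ hfM)
  rw [unnormSmoothing_succ] at hint ⊢
  rw [integrable_map_measure hf.aestronglyMeasurable hsn.aemeasurable,
    integrable_withDensity_iff_integrable_smul hd] at hint
  rw [integral_map hsn.aemeasurable hf.aestronglyMeasurable,
    integral_withDensity_eq_integral_smul hd]
  refine (integral_prod _ hint).trans ?_
  simp only [NNReal.smul_def, smul_eq_mul, NNReal.coe_mul]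
  rfl

theorem integrable_step {K : ℝ≥0} {t : ℕ} (hg : ∀ x, S.g x (y (t + 1)) ≤ K) (x : X)
    {f : X → ℝ} (hf : Measurable f) {M : ℝ} (hfM : ∀ x, |f x| ≤ M) :
    Integrable (fun x' => (S.m x x' : ℝ) * S.g x' (y (t + 1)) * f x') S.ν := by
  have hd : Measurable fun x' => S.m x x' * S.g x' (y (t + 1)) :=
    (S.measurable_m_right x).mul (S.measurable_g_right _)
  have h1 : Integrable (fun x' => ((S.m x x' * S.g x' (y (t + 1)) : ℝ≥0) : ℝ)) S.ν := by
    refine ⟨hd.coe_nnreal_real.aestronglyMeasurable, ?_⟩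
    rw [hasFiniteIntegral_iff_enorm]
    refine (le_of_eq ?_).trans_lt ((lintegral_step_le hg x).trans_lt ENNReal.coe_lt_top)
    refine lintegral_congr fun x' => ?_
    simp [enorm_eq_nnnorm]
  simpa using h1.mul_bdd hf.aestronglyMeasurable (ae_of_all _ hfM)

theorem integral_step_eq (t : ℕ) (x : X) :
    ∫ x', (S.m x x' : ℝ) * S.g x' (y (t + 1)) ∂S.ν
      = (∫⁻ x', ((S.m x x' * S.g x' (y (t + 1)) : ℝ≥0) : ℝ≥0∞) ∂S.ν).toReal := by
  have hd : Measurable fun x' => S.m x x' * S.g x' (y (t + 1)) :=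
    (S.measurable_m_right x).mul (S.measurable_g_right _)
  rw [← integral_toReal hd.coe_nnreal_ennreal.aemeasurable
    (ae_of_all _ fun _ => ENNReal.coe_lt_top)]
  simp

theorem integral_step_le {K : ℝ≥0} {t : ℕ} (hg : ∀ x, S.g x (y (t + 1)) ≤ K) (x : X) :
    ∫ x', (S.m x x' : ℝ) * S.g x' (y (t + 1)) ∂S.ν ≤ K := by
  rw [integral_step_eq]
  exact ENNReal.toReal_mono ENNReal.coe_ne_top (lintegral_step_le hg x)

theorem abs_pathStep_le {K : ℝ≥0} {t : ℕ} (hg : ∀ x, S.g x (y (t + 1)) ≤ K)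
    {f : (Fin (t + 2) → X) → ℝ} {M : ℝ} (hfM : ∀ x, |f x| ≤ M) (p : Fin (t + 1) → X) :
    |S.pathStep y t f p| ≤ K * M := by
  have hM : 0 ≤ M := (abs_nonneg _).trans (hfM (Fin.snoc p (p 0)))
  have hi := (integrable_step hg (p (Fin.last t)) (f := fun _ => M) measurable_const
    (M := M) (by simp [abs_of_nonneg hM]))
  calc |S.pathStep y t f p|
      ≤ ∫ x, (S.m (p (Fin.last t)) x : ℝ) * S.g x (y (t + 1)) * M ∂S.ν := by
        rw [← Real.norm_eq_abs]
        refine norm_integral_le_of_norm_le hi (ae_of_all _ fun x => ?_)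
        rw [norm_mul, Real.norm_of_nonneg (by positivity)]
        exact mul_le_mul_of_nonneg_left (hfM _) (by positivity)
    _ ≤ K * M := by
        rw [integral_mul_const]
        exact mul_le_mul_of_nonneg_right (integral_step_le hg _) hM

theorem measurable_pathStep (t : ℕ) {f : (Fin (t + 2) → X) → ℝ} (hf : Measurable f) :
    Measurable (S.pathStep y t f) := by
  have := S.sigmaFinite_ν
  have h : Measurable fun q : (Fin (t + 1) → X) × X =>
      (S.m (q.1 (Fin.last t)) q.2 : ℝ) * S.g q.2 (y (t + 1)) * f (Fin.snoc q.1 q.2) := by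
    have := (S.measurable_step_density y t).coe_nnreal_real.mul (hf.comp (Fin.measurable_snoc t))
    simpa only [NNReal.coe_mul] using! this
  exact h.stronglyMeasurable.integral_prod_right'.measurable

end StateSpaceModel

/-! ### Backward averages over index paths. -/

/-- The mean of `f (ξ_0^{j_0}, …, ξ_t^{j_t})` when `j_t = i` and the earlier indices are drawn
backwards in time, `j_s` from `L s j_{s+1}`. -/
noncomputable def backwardMean {X : Type*} {N : ℕ} (ξ : ℕ → Fin N → X)
    (L : ℕ → Fin N → Fin N → ℝ) : (t : ℕ) → Fin N → ((Fin (t + 1) → X) → ℝ) → ℝ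
  | 0, i, f => f (fun _ => ξ 0 i)
  | t + 1, i, f => ∑ j, L t i j * backwardMean ξ L t j (fun p => f (Fin.snoc p (ξ (t + 1) i)))

section BackwardMean

variable {X : Type*} {N : ℕ} {ξ : ℕ → Fin N → X} {L : ℕ → Fin N → Fin N → ℝ}

theorem backwardMean_const {t : ℕ} (hL : ∀ s < t, ∀ i, ∑ j, L s i j = 1) (i : Fin N) (c : ℝ) :
    backwardMean ξ L t i (fun _ => c) = c := by
  induction t generalizing i with
  | zero => rfl
  | succ t ih =>
    simp only [backwardMean]
    simp_rw [ih fun s hs => hL s (by omega)]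
    rw [← Finset.sum_mul, hL t (by omega), one_mul]

theorem abs_sum_mul_le {N : ℕ} {k b : Fin N → ℝ} {M : ℝ} (hk0 : ∀ j, 0 ≤ k j)
    (hk : ∑ j, k j = 1) (hb : ∀ j, |b j| ≤ M) : |∑ j, k j * b j| ≤ M :=
  calc |∑ j, k j * b j| ≤ ∑ j, k j * M := by
        refine (Finset.abs_sum_le_sum_abs _ _).trans (Finset.sum_le_sum fun j _ => ?_)
        rw [abs_mul, abs_of_nonneg (hk0 j)]
        exact mul_le_mul_of_nonneg_left (hb j) (hk0 j)
    _ = M := by rw [← Finset.sum_mul, hk, one_mul]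

theorem abs_backwardMean_le {t : ℕ} (hL0 : ∀ s i j, 0 ≤ L s i j)
    (hL : ∀ s < t, ∀ i, ∑ j, L s i j = 1) {f : (Fin (t + 1) → X) → ℝ} {M : ℝ}
    (hf : ∀ p, |f p| ≤ M) (i : Fin N) : |backwardMean ξ L t i f| ≤ M := by
  induction t generalizing i with
  | zero => exact hf _
  | succ t ih =>
    exact abs_sum_mul_le (hL0 t i) (hL t (by omega) i) fun j =>
      ih (fun s hs => hL s (by omega)) (fun p => hf _) j

theorem integrable_backwardMean {A : Type*} [MeasurableSpace A] {μ : Measure A} {t : ℕ}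
    {f : A → (Fin (t + 1) → X) → ℝ} (hf : ∀ p, Integrable (fun a => f a p) μ) (i : Fin N) :
    Integrable (fun a => backwardMean ξ L t i (f a)) μ := by
  induction t generalizing i with
  | zero => exact hf _
  | succ t ih =>
    simp only [backwardMean]
    exact integrable_finsetSum _ fun j _ =>
      (ih (f := fun a p => f a (Fin.snoc p (ξ (t + 1) i))) (fun p => hf _) j).const_mul _

/-- A backward mean is a finite linear combination of point evaluations, hence commutes with
integration in a parameter. -/
theorem integral_backwardMean {A : Type*} [MeasurableSpace A] {μ : Measure A} {t : ℕ}
    {f : A → (Fin (t + 1) → X) → ℝ} (hf : ∀ p, Integrable (fun a => f a p) μ) (i : Fin N) :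
    ∫ a, backwardMean ξ L t i (f a) ∂μ = backwardMean ξ L t i (fun p => ∫ a, f a p ∂μ) := by
  induction t generalizing i with
  | zero => rfl
  | succ t ih =>
    simp only [backwardMean]
    rw [integral_finsetSum _ fun j _ => (integrable_backwardMean
      (f := fun a p => f a (Fin.snoc p (ξ (t + 1) i))) (fun p => hf _) j).const_mul _]
    refine Finset.sum_congr rfl fun j _ => ?_
    rw [integral_const_mul, ih (f := fun a p => f a (Fin.snoc p (ξ (t + 1) i))) (fun p => hf _) j]

theorem backwardMean_mul_left (c : ℝ) (t : ℕ) (f : (Fin (t + 1) → X) → ℝ) (i : Fin N) :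
    backwardMean ξ L t i (fun p => c * f p) = c * backwardMean ξ L t i f := by
  induction t generalizing i with
  | zero => rfl
  | succ t ih =>
    simp only [backwardMean, Finset.mul_sum]
    refine Finset.sum_congr rfl fun j _ => ?_
    rw [ih (fun p => f (Fin.snoc p (ξ (t + 1) i))) j]
    ring

/-- The final state of every averaged path is the fixed point `ξ t i`, so a factor depending on that
state alone is constant. -/
theorem backwardMean_last_mul (c : X → ℝ) (t : ℕ) (f : (Fin (t + 1) → X) → ℝ) (i : Fin N) :
    backwardMean ξ L t i (fun p => c (p (Fin.last t)) * f p)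
      = c (ξ t i) * backwardMean ξ L t i f := by
  cases t with
  | zero => rfl
  | succ t =>
    simp only [backwardMean, Fin.snoc_last, backwardMean_mul_left, Finset.mul_sum]
    refine Finset.sum_congr rfl fun j _ => ?_
    ring

/-- Links the explicit probabilities of index paths with the recursive average. Summing over the
last index outermost reduces the claim at `t + 1` to the one at `t`, with `L t i` as the new
terminal coefficients. -/
theorem sum_prod_mul_eq_sum_backwardMean (t : ℕ) (c : Fin N → ℝ) (f : (Fin (t + 1) → X) → ℝ) :
    ∑ j : Fin (t + 1) → Fin N,
      c (j (Fin.last t)) * (∏ s : Fin t, L s (j s.succ) (j s.castSucc)) * f (fun s => ξ s (j s))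
      = ∑ i, c i * backwardMean ξ L t i f := by
  induction t generalizing c with
  | zero =>
    refine Fintype.sum_equiv (Equiv.funUnique (Fin 1) (Fin N)) _ _ fun j => ?_
    simp only [Finset.univ_eq_empty, Finset.prod_empty, mul_one, backwardMean]
    congr 2
    funext s
    rw [Fin.fin_one_eq_zero s]
    rfl
  | succ t ih =>
    rw [← Fintype.sum_equiv (Fin.snocEquiv fun _ : Fin (t + 2) => Fin N) (fun q =>
      c q.1 * (L t q.1 (q.2 (Fin.last t)) * (∏ s : Fin t, L s (q.2 s.succ) (q.2 s.castSucc)) *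
        f (Fin.snoc (fun s => ξ s (q.2 s)) (ξ (t + 1) q.1)))) _ ?_]
    · rw [Fintype.sum_prod_type]
      refine Finset.sum_congr rfl fun i _ => ?_
      simp only [backwardMean]
      rw [← ih (fun j => L t i j) (fun p => f (Fin.snoc p (ξ (t + 1) i))), Finset.mul_sum]
    · rintro ⟨i, j⟩
      rw [Fin.prod_univ_castSucc]
      simp only [Fin.snocEquiv, Equiv.coe_fn_mk, Fin.snoc_last, Fin.succ_last, Fin.snoc_castSucc,
        Fin.succ_castSucc, Fin.val_last, Fin.val_castSucc]
      have : (fun s : Fin (t + 2) => ξ s ((Fin.snoc j i : Fin (t + 2) → Fin N) s))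
          = Fin.snoc (fun s => ξ s (j s)) (ξ (t + 1) i) := by
        funext s
        refine Fin.lastCases ?_ (fun k => ?_) s
        · simp
        · simp
      rw [this]
      ring

theorem measurable_backwardMean [MeasurableSpace X] {A : Type*} [MeasurableSpace A]
    {ξ : A → ℕ → Fin N → X} {L : A → ℕ → Fin N → Fin N → ℝ} {t : ℕ}
    (hξ : ∀ s ≤ t, ∀ i, Measurable fun a => ξ a s i)
    (hL : ∀ s < t, ∀ i j, Measurable fun a => L a s i j)
    {f : A → (Fin (t + 1) → X) → ℝ} (hf : Measurable (Function.uncurry f)) (i : Fin N) :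
    Measurable fun a => backwardMean (ξ a) (L a) t i (f a) := by
  induction t generalizing i with
  | zero =>
    exact hf.comp (measurable_id.prodMk (measurable_pi_iff.2 fun _ => hξ 0 le_rfl i))
  | succ t ih =>
    simp only [backwardMean]
    refine Finset.measurable_sum _ fun j _ => (hL t (by omega) i j).mul ?_
    refine ih (fun s hs => hξ s (by omega)) (fun s hs => hL s (by omega))
      (f := fun a p => f a (Fin.snoc p (ξ a (t + 1) i))) ?_ j
    exact hf.comp (measurable_fst.prodMk ((Fin.measurable_snoc t).comp
      (measurable_snd.prodMk ((hξ (t + 1) le_rfl i).comp measurable_fst))))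

end BackwardMean

/-! ### Backward probabilities with a convention for empty rows. -/

/-- The probabilities proportional to `w j * c j`, or to `w j` if all the `w j * c j` vanish. -/
noncomputable def reweight {N : ℕ} (w c : Fin N → ℝ) (j : Fin N) : ℝ :=
  if ∑ l, w l * c l = 0 then w j / ∑ l, w l else w j * c j / ∑ l, w l * c l

section Reweight

variable {N : ℕ} {w c : Fin N → ℝ}

theorem reweight_nonneg (hw : ∀ j, 0 ≤ w j) (hc : ∀ j, 0 ≤ c j) (j : Fin N) :
    0 ≤ reweight w c j := by
  unfold reweight
  split_ifs
  · exact div_nonneg (hw j) (Finset.sum_nonneg fun l _ => hw l)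
  · exact div_nonneg (mul_nonneg (hw j) (hc j))
      (Finset.sum_nonneg fun l _ => mul_nonneg (hw l) (hc l))

/-- When the denominator is zero the left side is zero by convention while `reweight` is
nonnegative; otherwise the two agree. -/
theorem div_le_reweight (hw : ∀ j, 0 ≤ w j) (hc : ∀ j, 0 ≤ c j) (j : Fin N) :
    w j * c j / ∑ l, w l * c l ≤ reweight w c j := by
  have := reweight_nonneg hw hc j
  unfold reweight at *
  split_ifs with h
  · rw [if_pos h] at this
    simpa [h] using this
  · exact le_rfl

theorem sum_reweight (hw : ∑ l, w l ≠ 0) : ∑ j, reweight w c j = 1 := by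
  unfold reweight
  split_ifs with h
  · rw [← Finset.sum_div, div_self hw]
  · rw [← Finset.sum_div, div_self h]

/-- Valid in the degenerate case too, since nonnegative terms with sum zero all vanish. For this
reason the fallback value in `reweight` never enters a mean. -/
theorem sum_mul_reweight (hw : ∀ j, 0 ≤ w j) (hc : ∀ j, 0 ≤ c j) (j : Fin N) :
    (∑ l, w l * c l) * reweight w c j = w j * c j := by
  unfold reweight
  split_ifs with h
  · rw [h, zero_mul]
    exact ((Finset.sum_eq_zero_iff_of_nonneg fun l _ => mul_nonneg (hw l) (hc l)).1 h j
      (Finset.mem_univ j)).symm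
  · field_simp

theorem measurable_reweight {A : Type*} [MeasurableSpace A] {w c : A → Fin N → ℝ}
    (hw : ∀ j, Measurable fun a => w a j) (hc : ∀ j, Measurable fun a => c a j) (j : Fin N) :
    Measurable fun a => reweight (w a) (c a) j := by
  unfold reweight
  have h : Measurable fun a => ∑ l, w a l * c a l :=
    Finset.measurable_sum _ fun l _ => (hw l).mul (hc l)
  exact Measurable.ite (h (measurableSet_singleton 0))
    ((hw j).div (Finset.measurable_sum _ fun l _ => hw l)) (((hw j).mul (hc j)).div h)

end Reweight

/-! ### Smoothing estimates built from given weighted particles. -/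

namespace StateSpaceModel

variable {X Y : Type*} [MeasurableSpace X] [MeasurableSpace Y] (S : StateSpaceModel X Y)
  (y : ℕ → Y) {N : ℕ} (ξ : ℕ → Fin N → X) (W : ℕ → Fin N → ℝ)

/-- The backward transition probabilities of weighted particles (extended to states that no
particle of positive weight can reach). -/
noncomputable def backwardProb (t : ℕ) (i : Fin N) : Fin N → ℝ :=
  reweight (W t) (fun l => (S.m (ξ t l) (ξ (t + 1) i) : ℝ))

/-- The value at `x` of the backward mean of `f` for a particle at `x` at time `t + 1`. -/
noncomputable def nextMean (t : ℕ) (f : (Fin (t + 2) → X) → ℝ) (x : X) : ℝ :=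
  ∑ j, reweight (W t) (fun l => (S.m (ξ t l) x : ℝ)) j *
    backwardMean ξ (S.backwardProb ξ W) t j (fun p => f (Fin.snoc p x))

/-- The forward filtering backward smoothing estimate of the joint smoothing distribution. -/
noncomputable def particleMean (t : ℕ) (f : (Fin (t + 1) → X) → ℝ) : ℝ :=
  (∑ i, W t i * backwardMean ξ (S.backwardProb ξ W) t i f) / ∑ i, W t i

variable {S y ξ W}

theorem abs_nextMean_le {t : ℕ} (hW0 : ∀ s i, 0 ≤ W s i) (hW : ∀ s ≤ t, ∑ i, W s i ≠ 0)
    {f : (Fin (t + 2) → X) → ℝ} {M : ℝ} (hf : ∀ p, |f p| ≤ M) (x : X) :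
    |S.nextMean ξ W t f x| ≤ M :=
  abs_sum_mul_le (reweight_nonneg (hW0 t) (fun _ => NNReal.coe_nonneg _))
    (sum_reweight (hW t le_rfl)) fun j => abs_backwardMean_le
      (fun s _ => reweight_nonneg (hW0 s) (fun _ => NNReal.coe_nonneg _))
      (fun s hs _ => sum_reweight (hW s hs.le)) (fun _ => hf _) j

theorem sum_backwardProb {s : ℕ} (hW : ∑ i, W s i ≠ 0) (i : Fin N) :
    ∑ j, S.backwardProb ξ W s i j = 1 := sum_reweight hW

/-- The central cancellation: the mixture density at `x` is the normalising sum of the backward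
probabilities out of `x`, so multiplying by it leaves an expression without denominators involving
`x`. -/
theorem sum_mul_nextMean {t : ℕ} (hW0 : ∀ s i, 0 ≤ W s i) (f : (Fin (t + 2) → X) → ℝ) (x : X) :
    (∑ l, W t l * (S.m (ξ t l) x : ℝ)) * S.nextMean ξ W t f x
      = ∑ j, W t j * (S.m (ξ t j) x *
        backwardMean ξ (S.backwardProb ξ W) t j (fun p => f (Fin.snoc p x))) := by
  unfold nextMean
  rw [Finset.mul_sum]
  refine Finset.sum_congr rfl fun j _ => ?_
  rw [← mul_assoc, sum_mul_reweight (hW0 t) (fun _ => NNReal.coe_nonneg _), mul_assoc]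

/-- Integrating the backward mean against the mixture `∑_l W_t^l m(ξ_t^l, x) g_{t+1}(x) ν(dx)`
gives the unnormalised particle estimate of `pathStep f`. -/
theorem integral_sum_mul_nextMean {K : ℝ≥0} {t : ℕ} (hg : ∀ x, S.g x (y (t + 1)) ≤ K)
    (hW0 : ∀ s i, 0 ≤ W s i) {f : (Fin (t + 2) → X) → ℝ} (hf : Measurable f) {M : ℝ}
    (hfM : ∀ x, |f x| ≤ M) :
    ∫ x, (∑ l, W t l * (S.m (ξ t l) x : ℝ)) * S.g x (y (t + 1)) * S.nextMean ξ W t f x ∂S.ν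
      = ∑ j, W t j * backwardMean ξ (S.backwardProb ξ W) t j (S.pathStep y t f) := by
  have hi : ∀ p : Fin (t + 1) → X, Integrable (fun x =>
      (S.m (p (Fin.last t)) x : ℝ) * S.g x (y (t + 1)) * f (Fin.snoc p x)) S.ν := fun p =>
    integrable_step hg _ (hf.comp ((Fin.measurable_snoc t).comp measurable_prodMk_left))
      (fun x => hfM _)
  -- After the cancellation, `m(ξ_j, x) g(x)` moves inside the backward mean as a function of the
  -- final state; integrating in `x` then produces `pathStep`.
  have e : ∀ x, (∑ l, W t l * (S.m (ξ t l) x : ℝ)) * S.g x (y (t + 1)) * S.nextMean ξ W t f x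
      = ∑ j, W t j * backwardMean ξ (S.backwardProb ξ W) t j (fun p =>
        (S.m (p (Fin.last t)) x : ℝ) * S.g x (y (t + 1)) * f (Fin.snoc p x)) := by
    intro x
    rw [mul_right_comm, sum_mul_nextMean hW0, Finset.sum_mul]
    refine Finset.sum_congr rfl fun j _ => ?_
    rw [backwardMean_last_mul (fun z => (S.m z x : ℝ) * S.g x (y (t + 1))) t
      (fun p => f (Fin.snoc p x))]
    ring
  simp_rw [e]
  rw [integral_finsetSum _ fun j _ => (integrable_backwardMean hi j).const_mul _]
  refine Finset.sum_congr rfl fun j _ => ?_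
  rw [integral_const_mul, integral_backwardMean hi j]
  rfl

theorem measurable_backwardProb {A : Type*} [MeasurableSpace A] {ξ : A → ℕ → Fin N → X}
    {W : A → ℕ → Fin N → ℝ} {s : ℕ} (hξ : ∀ i, Measurable fun a => ξ a s i)
    (hξ' : ∀ i, Measurable fun a => ξ a (s + 1) i) (hW : ∀ i, Measurable fun a => W a s i)
    (i j : Fin N) : Measurable fun a => S.backwardProb (ξ a) (W a) s i j :=
  measurable_reweight (w := fun a => W a s) hW
    (fun l => (S.measurable_m_comp (hξ l) (hξ' i)).coe_nnreal_real) j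

theorem measurable_nextMean {A : Type*} [MeasurableSpace A] {ξ : A → ℕ → Fin N → X}
    {W : A → ℕ → Fin N → ℝ} {t : ℕ} (hξ : ∀ s ≤ t, ∀ i, Measurable fun a => ξ a s i)
    (hW : ∀ s ≤ t, ∀ i, Measurable fun a => W a s i) {f : (Fin (t + 2) → X) → ℝ}
    (hf : Measurable f) :
    Measurable (Function.uncurry fun a x => S.nextMean (ξ a) (W a) t f x) := by
  simp only [nextMean, Function.uncurry_def]
  refine Finset.measurable_sum _ fun j _ => Measurable.mul ?_ ?_
  · exact measurable_reweight (w := fun q : A × X => W q.1 t)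
      (fun i => (hW t le_rfl i).comp measurable_fst)
      (fun l => (S.measurable_m_comp ((hξ t le_rfl l).comp measurable_fst)
        measurable_snd).coe_nnreal_real) j
  · refine measurable_backwardMean (ξ := fun q : A × X => ξ q.1)
      (L := fun q : A × X => S.backwardProb (ξ q.1) (W q.1))
      (f := fun (q : A × X) p => f (Fin.snoc p q.2))
      (fun s hs i => (hξ s hs i).comp measurable_fst)
      (fun s hs i j => (measurable_backwardProb (hξ s hs.le) (hξ (s + 1) hs)
        (hW s hs.le) i j).comp measurable_fst) ?_ j
    exact hf.comp ((Fin.measurable_snoc t).comp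
      (measurable_snd.prodMk (measurable_snd.comp measurable_fst)))

theorem measurable_nextMean_const (t : ℕ) (ξ : ℕ → Fin N → X) (W : ℕ → Fin N → ℝ)
    {f : (Fin (t + 2) → X) → ℝ} (hf : Measurable f) : Measurable (S.nextMean ξ W t f) := by
  have h := measurable_nextMean (S := S) (A := Unit) (ξ := fun _ => ξ) (W := fun _ => W) (t := t)
    (fun _ _ _ => measurable_const) (fun _ _ _ => measurable_const) hf
  exact h.of_uncurry_left (x := ())

theorem measurable_particleMean {A : Type*} [MeasurableSpace A] {ξ : A → ℕ → Fin N → X}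
    {W : A → ℕ → Fin N → ℝ} {t : ℕ} (hξ : ∀ s ≤ t, ∀ i, Measurable fun a => ξ a s i)
    (hW : ∀ s ≤ t, ∀ i, Measurable fun a => W a s i) {f : (Fin (t + 1) → X) → ℝ}
    (hf : Measurable f) : Measurable fun a => S.particleMean (ξ a) (W a) t f := by
  refine Measurable.div (Finset.measurable_sum _ fun i _ => (hW t le_rfl i).mul ?_)
    (Finset.measurable_sum _ fun i _ => hW t le_rfl i)
  exact measurable_backwardMean hξ (fun s hs i j => measurable_backwardProb (hξ s hs.le)
    (hξ (s + 1) hs) (hW s hs.le) i j) (f := fun _ => f) (hf.comp measurable_snd) i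

end StateSpaceModel

/-! ### Importance weights, the history and the instrumental distribution. -/

namespace AuxiliaryProposal

variable {X Y : Type*} [MeasurableSpace X] [MeasurableSpace Y] {S : StateSpaceModel X Y}

section WeightFunctions

variable (Q : AuxiliaryProposal S) (y : ℕ → Y)

theorem measurable_weightFun₀ : Measurable (Q.weightFun₀ y) :=
  (Measure.measurable_rnDeriv _ _).mul (S.measurable_g_right _).coe_nnreal_ennreal

theorem measurable_weightFun (t : ℕ) : Measurable (Function.uncurry (Q.weightFun y t)) := by
  refine Measurable.div (Measurable.mul S.measurable_m.coe_nnreal_ennreal ?_)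
    (Measurable.mul ?_ (Q.measurable_q t).coe_nnreal_ennreal)
  · exact ((S.measurable_g_right _).comp measurable_snd).coe_nnreal_ennreal
  · exact ((Q.measurable_ϑ t).comp measurable_fst).coe_nnreal_ennreal

variable {Q y}

/-- A finite weight excludes a positive numerator over a zero denominator, so the division can be
undone, the case `0 / 0` included. -/
theorem weightFun_mul {t : ℕ} {K : ℝ≥0} {x x' : X} (h : Q.weightFun y t x x' ≤ K) :
    Q.weightFun y t x x' * ((Q.ϑ t x : ℝ≥0∞) * Q.q t x x') = S.m x x' * S.g x' (y t) := by
  refine ENNReal.div_mul_cancel' (fun h0 => ?_) fun h0 => ?_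
  · by_contra hne
    rw [weightFun, h0, ENNReal.div_zero hne] at h
    exact ENNReal.coe_ne_top (top_le_iff.1 h)
  · exact absurd h0 (ENNReal.mul_ne_top ENNReal.coe_ne_top ENNReal.coe_ne_top)

theorem toReal_weightFun_mul {t : ℕ} {K : ℝ≥0} {x x' : X} (h : Q.weightFun y t x x' ≤ K) :
    (Q.weightFun y t x x').toReal * (Q.ϑ t x * Q.q t x x') = S.m x x' * S.g x' (y t) := by
  have := congrArg ENNReal.toReal (weightFun_mul h)
  simpa [ENNReal.toReal_mul] using this

/-- If `ϑ` vanished at `x`, then so would `m(x, ·) g = ω ϑ q`, against `lintegral_step_ne_zero`.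
Hence multiplying by `ϑ` cannot make a nonzero sum of weights vanish. -/
theorem ϑ_pos {t : ℕ} {K : ℝ≥0} (h : ∀ x x', Q.weightFun y t x x' ≤ K)
    (hg : ∀ x, 0 < S.g x (y t)) (x : X) : 0 < Q.ϑ t x := by
  rw [pos_iff_ne_zero]
  intro h0
  refine S.lintegral_step_ne_zero hg x ?_
  rw [← lintegral_zero (μ := S.ν)]
  refine lintegral_congr fun x' => ?_
  rw [ENNReal.coe_mul, ← weightFun_mul (h x x'), h0]
  simp

end WeightFunctions

variable {Ω : Type*} {N : ℕ} (Q : AuxiliaryProposal S) (y : ℕ → Y)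
  (ξ : ℕ → Fin N → Ω → X) (I : ℕ → Fin N → Ω → Fin N)

/-- The importance weights as real numbers. -/
noncomputable def realWeight (ω : Ω) (t : ℕ) (i : Fin N) : ℝ := (Q.weight y ξ I t i ω).toReal

/-- The event that the weights do not degenerate up to time `t` and the initial ones respect the
bound `K`. -/
def regularEvent (K : ℝ≥0) (t : ℕ) : Set Ω :=
  {ω | ω ∈ Q.nondegenerate y ξ I t ∧ ∀ i, Q.weight y ξ I 0 i ω ≤ K}

theorem measurable_history {s t : ℕ} (hst : s ≤ t) (i : Fin N) :
    Measurable[Q.history y ξ I t] fun ω => (ξ s i ω, Q.weight y ξ I s i ω) := by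
  refine Measurable.mono (comap_measurable _) ?_ le_rfl
  exact le_iSup_of_le s (le_iSup_of_le hst (le_iSup (fun i => MeasurableSpace.comap
    (fun ω => (ξ s i ω, Q.weight y ξ I s i ω)) inferInstance) i))

theorem measurable_history_particle {s t : ℕ} (hst : s ≤ t) (i : Fin N) :
    Measurable[Q.history y ξ I t] (ξ s i) :=
  measurable_fst.comp (Q.measurable_history y ξ I hst i)

theorem measurable_history_weight {s t : ℕ} (hst : s ≤ t) (i : Fin N) :
    Measurable[Q.history y ξ I t] (Q.weight y ξ I s i) :=
  measurable_snd.comp (Q.measurable_history y ξ I hst i)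

theorem measurable_history_realWeight {s t : ℕ} (hst : s ≤ t) (i : Fin N) :
    Measurable[Q.history y ξ I t] fun ω => Q.realWeight y ξ I ω s i :=
  ENNReal.measurable_toReal.comp (Q.measurable_history_weight y ξ I hst i)

theorem measurableSet_regularEvent (K : ℝ≥0) (t : ℕ) :
    MeasurableSet[Q.history y ξ I t] (Q.regularEvent y ξ I K t) := by
  have h1 : MeasurableSet[Q.history y ξ I t] (Q.nondegenerate y ξ I t) := by
    have : Q.nondegenerate y ξ I t
        = ⋂ (s : ℕ) (_ : s ≤ t), {ω | ∑ i, Q.weight y ξ I s i ω ≠ 0} := by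
      ext ω; simp [nondegenerate]
    rw [this]
    refine MeasurableSet.iInter fun s => MeasurableSet.iInter fun hs => ?_
    have hm : Measurable[Q.history y ξ I t] fun ω => ∑ i, Q.weight y ξ I s i ω :=
      Finset.measurable_sum _ fun i _ => Q.measurable_history_weight y ξ I hs i
    exact hm (measurableSet_singleton 0).compl
  have h2 : MeasurableSet[Q.history y ξ I t] {ω | ∀ i, Q.weight y ξ I 0 i ω ≤ K} := by
    have : {ω | ∀ i, Q.weight y ξ I 0 i ω ≤ K} = ⋂ i, (Q.weight y ξ I 0 i) ⁻¹' Set.Iic (K : ℝ≥0∞) := by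
      ext ω; simp
    rw [this]
    exact MeasurableSet.iInter fun i =>
      (Q.measurable_history_weight y ξ I (Nat.zero_le t) i) measurableSet_Iic
  exact h1.inter h2

variable {Q y ξ I}

theorem measurable_weight [MeasurableSpace Ω] {T : ℕ} (hξ : ∀ t ≤ T, ∀ i, Measurable (ξ t i))
    (hI : ∀ t, 1 ≤ t → t ≤ T → ∀ i, Measurable (I t i)) {t : ℕ} (ht : t ≤ T) (i : Fin N) :
    Measurable (Q.weight y ξ I t i) := by
  cases t with
  | zero => exact (Q.measurable_weightFun₀ y).comp (hξ 0 ht i)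
  | succ t =>
    have h1 : Measurable fun q : Fin N × Ω => ξ t q.1 q.2 :=
      measurable_from_prod_countable_right fun j => hξ t (by omega) j
    exact (Q.measurable_weightFun y (t + 1)).comp
      ((h1.comp ((hI (t + 1) (by omega) ht i).prodMk measurable_id)).prodMk (hξ (t + 1) ht i))

theorem history_le [mΩ : MeasurableSpace Ω] {T : ℕ} (hξ : ∀ t ≤ T, ∀ i, Measurable (ξ t i))
    (hI : ∀ t, 1 ≤ t → t ≤ T → ∀ i, Measurable (I t i)) {t : ℕ} (ht : t ≤ T) :
    Q.history y ξ I t ≤ mΩ :=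
  iSup_le fun s => iSup_le fun hs => iSup_le fun i => Measurable.comap_le
    ((hξ s (hs.trans ht) i).prodMk (measurable_weight hξ hI (hs.trans ht) i))

theorem weight_le {K : ℝ≥0} {T t : ℕ}
    (hK : ∀ t, 1 ≤ t → t ≤ T → ∀ x x', Q.weightFun y t x x' ≤ K)
    {ω : Ω} (hω : ω ∈ Q.regularEvent y ξ I K t) {s : ℕ} (hs : s ≤ T) (i : Fin N) :
    Q.weight y ξ I s i ω ≤ K := by
  cases s with
  | zero => exact hω.2 i
  | succ s => exact hK _ (by omega) hs _ _

theorem realWeight_nonneg (ω : Ω) (t : ℕ) (i : Fin N) : 0 ≤ Q.realWeight y ξ I ω t i :=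
  ENNReal.toReal_nonneg

theorem sum_realWeight {K : ℝ≥0} {T t : ℕ}
    (hK : ∀ t, 1 ≤ t → t ≤ T → ∀ x x', Q.weightFun y t x x' ≤ K)
    {ω : Ω} (hω : ω ∈ Q.regularEvent y ξ I K t) {s : ℕ} (hs : s ≤ T) :
    ∑ i, Q.realWeight y ξ I ω s i = (∑ i, Q.weight y ξ I s i ω).toReal :=
  (ENNReal.toReal_sum fun i _ => ((weight_le hK hω hs i).trans_lt ENNReal.coe_lt_top).ne).symm

theorem sum_realWeight_ne_zero {K : ℝ≥0} {T t : ℕ}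
    (hK : ∀ t, 1 ≤ t → t ≤ T → ∀ x x', Q.weightFun y t x x' ≤ K) (htT : t ≤ T)
    {ω : Ω} (hω : ω ∈ Q.regularEvent y ξ I K t) {s : ℕ} (hs : s ≤ t) :
    ∑ i, Q.realWeight y ξ I ω s i ≠ 0 := by
  rw [sum_realWeight hK hω (hs.trans htT)]
  exact (ENNReal.toReal_pos (hω.1 s hs) (ENNReal.sum_lt_top.2 fun i _ =>
    (weight_le hK hω (hs.trans htT) i).trans_lt ENNReal.coe_lt_top).ne).ne'

theorem measurable_instrumental_apply (t : ℕ) {B : Set (Fin N × X)} (hB : MeasurableSet B) :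
    Measurable[Q.history y ξ I t] fun ω => Q.instrumental y ξ I t ω B := by
  have := S.sigmaFinite_ν
  have hw := fun i => Q.measurable_history_weight y ξ I (le_refl t) i
  have hx := fun i => Q.measurable_history_particle y ξ I (le_refl t) i
  have hϑ : ∀ i, Measurable[Q.history y ξ I t]
      fun ω => Q.weight y ξ I t i ω * (Q.ϑ (t + 1) (ξ t i ω) : ℝ≥0∞) := fun i =>
    (hw i).mul ((Q.measurable_ϑ (t + 1)).coe_nnreal_ennreal.comp (hx i))
  have e : ∀ ω, Q.instrumental y ξ I t ω B
      = ∑ i, ((Q.weight y ξ I t i ω * Q.ϑ (t + 1) (ξ t i ω)) /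
        ∑ l, Q.weight y ξ I t l ω * Q.ϑ (t + 1) (ξ t l ω)) *
        ∫⁻ x in Prod.mk i ⁻¹' B, (Q.q (t + 1) (ξ t i ω) x : ℝ≥0∞) ∂S.ν := by
    intro ω
    simp only [instrumental, Measure.coe_finsetSum, Finset.sum_apply, Measure.smul_apply,
      smul_eq_mul]
    refine Finset.sum_congr rfl fun i _ => ?_
    rw [Measure.dirac_prod, Measure.map_apply measurable_prodMk_left hB,
      withDensity_apply _ (measurable_prodMk_left hB)]
  simp_rw [e]
  refine Finset.measurable_sum _ fun i _ => Measurable.mul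
    ((hϑ i).div (Finset.measurable_sum _ fun l _ => hϑ l)) ?_
  have h1 : Measurable fun z => ∫⁻ x in Prod.mk i ⁻¹' B, (Q.q (t + 1) z x : ℝ≥0∞) ∂S.ν :=
    (Q.measurable_q (t + 1)).coe_nnreal_ennreal.lintegral_prod_right'
  exact h1.comp (hx i)

theorem sum_weight_mul_ϑ_ne_zero {K : ℝ≥0} {T t : ℕ}
    (hK : ∀ t, 1 ≤ t → t ≤ T → ∀ x x', Q.weightFun y t x x' ≤ K)
    (hg : ∀ s ≤ T, ∀ x, 0 < S.g x (y s)) (htT : t < T)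
    {ω : Ω} (hω : ω ∈ Q.regularEvent y ξ I K t) :
    ∑ l, Q.weight y ξ I t l ω * (Q.ϑ (t + 1) (ξ t l ω) : ℝ≥0∞) ≠ 0 := by
  intro h
  refine hω.1 t le_rfl (Finset.sum_eq_zero fun l hl => ?_)
  have hpos := ϑ_pos (hK (t + 1) (by omega) htT) (hg (t + 1) htT) (ξ t l ω)
  exact (mul_eq_zero.1 (Finset.sum_eq_zero_iff.1 h l hl)).resolve_right
    (ENNReal.coe_ne_zero.2 hpos.ne')

theorem sum_weight_mul_ϑ_ne_top {K : ℝ≥0} {T t : ℕ}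
    (hK : ∀ t, 1 ≤ t → t ≤ T → ∀ x x', Q.weightFun y t x x' ≤ K) (htT : t < T)
    {ω : Ω} (hω : ω ∈ Q.regularEvent y ξ I K t) :
    ∑ l, Q.weight y ξ I t l ω * (Q.ϑ (t + 1) (ξ t l ω) : ℝ≥0∞) ≠ ∞ :=
  (ENNReal.sum_lt_top.2 fun l _ => ENNReal.mul_lt_top
    ((weight_le hK hω htT.le l).trans_lt ENNReal.coe_lt_top) ENNReal.coe_lt_top).ne

theorem instrumental_univ {K : ℝ≥0} {T t : ℕ}
    (hK : ∀ t, 1 ≤ t → t ≤ T → ∀ x x', Q.weightFun y t x x' ≤ K)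
    (hg : ∀ s ≤ T, ∀ x, 0 < S.g x (y s)) (htT : t < T)
    {ω : Ω} (hω : ω ∈ Q.regularEvent y ξ I K t) :
    Q.instrumental y ξ I t ω Set.univ = 1 := by
  have := S.sigmaFinite_ν
  simp only [instrumental, Measure.coe_finsetSum, Finset.sum_apply, Measure.smul_apply,
    smul_eq_mul]
  have h1 : ∀ i : Fin N, ((Measure.dirac i).prod
      (S.ν.withDensity fun x' => (Q.q (t + 1) (ξ t i ω) x' : ℝ≥0∞))) Set.univ = 1 := by
    intro i
    rw [Measure.dirac_prod, Measure.map_apply measurable_prodMk_left MeasurableSet.univ,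
      Set.preimage_univ, withDensity_apply _ MeasurableSet.univ, Measure.restrict_univ,
      Q.lintegral_q]
  simp only [h1, mul_one, div_eq_mul_inv, ← Finset.sum_mul]
  exact ENNReal.mul_inv_cancel (sum_weight_mul_ϑ_ne_zero hK hg htT hω)
    (sum_weight_mul_ϑ_ne_top hK htT hω)

theorem toReal_instrumental_coeff {K : ℝ≥0} {T t : ℕ}
    (hK : ∀ t, 1 ≤ t → t ≤ T → ∀ x x', Q.weightFun y t x x' ≤ K) (htT : t < T)
    {ω : Ω} (hω : ω ∈ Q.regularEvent y ξ I K t) (i : Fin N) :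
    ((Q.weight y ξ I t i ω * (Q.ϑ (t + 1) (ξ t i ω) : ℝ≥0∞)) /
      ∑ l, Q.weight y ξ I t l ω * (Q.ϑ (t + 1) (ξ t l ω) : ℝ≥0∞)).toReal
    = Q.realWeight y ξ I ω t i * Q.ϑ (t + 1) (ξ t i ω) /
      ∑ l, Q.realWeight y ξ I ω t l * Q.ϑ (t + 1) (ξ t l ω) := by
  rw [ENNReal.toReal_div, ENNReal.toReal_sum fun l _ => ENNReal.mul_ne_top
    ((weight_le hK hω htT.le l).trans_lt ENNReal.coe_lt_top).ne ENNReal.coe_ne_top]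
  simp [ENNReal.toReal_mul, realWeight]

theorem integral_instrumental_eq_sum {K : ℝ≥0} {T t : ℕ}
    (hK : ∀ t, 1 ≤ t → t ≤ T → ∀ x x', Q.weightFun y t x x' ≤ K)
    (hg : ∀ s ≤ T, ∀ x, 0 < S.g x (y s)) (htT : t < T)
    {ω : Ω} (hω : ω ∈ Q.regularEvent y ξ I K t) {Ψ : Fin N × X → ℝ} (hΨ : Measurable Ψ)
    {M : ℝ} (hΨM : ∀ z, |Ψ z| ≤ M) :
    ∫ z, Ψ z ∂Q.instrumental y ξ I t ω
      = ∑ i, Q.realWeight y ξ I ω t i * Q.ϑ (t + 1) (ξ t i ω) /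
          (∑ l, Q.realWeight y ξ I ω t l * Q.ϑ (t + 1) (ξ t l ω)) *
          ∫ x, (Q.q (t + 1) (ξ t i ω) x : ℝ) * Ψ (i, x) ∂S.ν := by
  have := S.sigmaFinite_ν
  have hprob : ∀ i, IsProbabilityMeasure
      (S.ν.withDensity fun x' => (Q.q (t + 1) (ξ t i ω) x' : ℝ≥0∞)) := fun i =>
    ⟨by rw [withDensity_apply _ MeasurableSet.univ, Measure.restrict_univ, Q.lintegral_q]⟩
  have hqm : ∀ i, Measurable fun x' => Q.q (t + 1) (ξ t i ω) x' := fun i =>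
    (Q.measurable_q (t + 1)).comp measurable_prodMk_left
  have hc : ∀ i, (Q.weight y ξ I t i ω * (Q.ϑ (t + 1) (ξ t i ω) : ℝ≥0∞)) /
      ∑ l, Q.weight y ξ I t l ω * (Q.ϑ (t + 1) (ξ t l ω) : ℝ≥0∞) ≠ ∞ := fun i =>
    ENNReal.div_ne_top (ENNReal.mul_ne_top
      ((weight_le hK hω htT.le i).trans_lt ENNReal.coe_lt_top).ne ENNReal.coe_ne_top)
      (sum_weight_mul_ϑ_ne_zero hK hg htT hω)
  unfold instrumental
  rw [integral_finsetSum_measure fun i _ => (Integrable.of_bound (μ := (Measure.dirac i).prod _)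
    hΨ.aestronglyMeasurable M (ae_of_all _ hΨM)).smul_measure (hc i)]
  refine Finset.sum_congr rfl fun i _ => ?_
  rw [integral_smul_measure, toReal_instrumental_coeff hK htT hω, Measure.dirac_prod,
    integral_map measurable_prodMk_left.aemeasurable hΨ.aestronglyMeasurable,
    integral_withDensity_eq_integral_smul (hqm i), smul_eq_mul]
  rfl

theorem measurable_weightFun_mul_nextMean (t : ℕ) (ω : Ω) (Ξ : ℕ → Fin N → X)
    (W : ℕ → Fin N → ℝ) {f : (Fin (t + 2) → X) → ℝ} (hf : Measurable f) :
    Measurable fun z : Fin N × X =>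
      (Q.weightFun y (t + 1) (ξ t z.1 ω) z.2).toReal * S.nextMean Ξ W t f z.2 := by
  have hnm := StateSpaceModel.measurable_nextMean_const (S := S) t Ξ W hf
  have hw : ∀ x, Measurable fun x' => (Q.weightFun y (t + 1) x x').toReal := fun x =>
    ENNReal.measurable_toReal.comp ((Q.measurable_weightFun y (t + 1)).of_uncurry_left (x := x))
  refine measurable_from_prod_countable_right fun i => ?_
  exact (hw (ξ t i ω)).mul hnm

theorem abs_weightFun_mul_le {K : ℝ≥0} {t : ℕ}
    (hK : ∀ x x', Q.weightFun y t x x' ≤ K) {a M : ℝ} (ha : |a| ≤ M) (x x' : X) :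
    |(Q.weightFun y t x x').toReal * a| ≤ K * M := by
  rw [abs_mul, abs_of_nonneg ENNReal.toReal_nonneg]
  exact mul_le_mul (ENNReal.toReal_mono ENNReal.coe_ne_top (hK _ _)) ha (abs_nonneg _)
    K.coe_nonneg

/-- The conditional mean, under the instrumental distribution, of a weighted backward mean. -/
theorem integral_instrumental {K Kg : ℝ≥0} {T t : ℕ}
    (hK : ∀ t, 1 ≤ t → t ≤ T → ∀ x x', Q.weightFun y t x x' ≤ K)
    (hg : ∀ s ≤ T, ∀ x, 0 < S.g x (y s)) (hKg : ∀ s ≤ T, ∀ x, S.g x (y s) ≤ Kg) (htT : t < T)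
    {ω : Ω} (hω : ω ∈ Q.regularEvent y ξ I K t) {f : (Fin (t + 2) → X) → ℝ} (hf : Measurable f)
    {M : ℝ} (hfM : ∀ x, |f x| ≤ M) :
    ∫ z, (Q.weightFun y (t + 1) (ξ t z.1 ω) z.2).toReal *
        S.nextMean (fun s i => ξ s i ω) (Q.realWeight y ξ I ω) t f z.2 ∂Q.instrumental y ξ I t ω
      = (∑ i, Q.realWeight y ξ I ω t i) /
          (∑ i, Q.realWeight y ξ I ω t i * Q.ϑ (t + 1) (ξ t i ω)) *
        S.particleMean (fun s i => ξ s i ω) (Q.realWeight y ξ I ω) t (S.pathStep y t f) := by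
  have hW0 : ∀ s i, 0 ≤ Q.realWeight y ξ I ω s i := fun s i => realWeight_nonneg ω s i
  have hW : ∀ s ≤ t, ∑ i, Q.realWeight y ξ I ω s i ≠ 0 := fun s hs =>
    sum_realWeight_ne_zero hK htT.le hω hs
  have hΨm := measurable_weightFun_mul_nextMean (Q := Q) (y := y) (ξ := ξ) t ω
    (fun s i => ξ s i ω) (Q.realWeight y ξ I ω) hf
  have hnb : ∀ x, |S.nextMean (fun s i => ξ s i ω) (Q.realWeight y ξ I ω) t f x| ≤ M :=
    StateSpaceModel.abs_nextMean_le hW0 hW hfM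
  have hnm := StateSpaceModel.measurable_nextMean_const (S := S) t (fun s i => ξ s i ω)
    (Q.realWeight y ξ I ω) hf
  rw [integral_instrumental_eq_sum hK hg htT hω hΨm
    fun z => abs_weightFun_mul_le (hK (t + 1) (by omega) htT) (hnb z.2) _ _]
  have hmain := StateSpaceModel.integral_sum_mul_nextMean (S := S) (y := y) (t := t)
    (ξ := fun s i => ξ s i ω) (W := Q.realWeight y ξ I ω) (hKg (t + 1) htT) hW0 hf hfM
  have hint : ∀ i, Integrable (fun x => Q.realWeight y ξ I ω t i * ((S.m (ξ t i ω) x : ℝ) *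
      S.g x (y (t + 1)) * S.nextMean (fun s i => ξ s i ω) (Q.realWeight y ξ I ω) t f x)) S.ν :=
    fun i => (StateSpaceModel.integrable_step (hKg (t + 1) htT) (ξ t i ω) hnm hnb).const_mul _
  have hsum : ∑ i, ∫ x, Q.realWeight y ξ I ω t i * ((S.m (ξ t i ω) x : ℝ) *
      S.g x (y (t + 1)) * S.nextMean (fun s i => ξ s i ω) (Q.realWeight y ξ I ω) t f x) ∂S.ν
      = ∑ j, Q.realWeight y ξ I ω t j * backwardMean (fun s i => ξ s i ω)
        (S.backwardProb (fun s i => ξ s i ω) (Q.realWeight y ξ I ω)) t j (S.pathStep y t f) := by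
    rw [← hmain, ← integral_finsetSum _ fun i _ => hint i]
    refine integral_congr_ae (ae_of_all _ fun x => ?_)
    simp only [Finset.sum_mul]
    exact Finset.sum_congr rfl fun i _ => by ring
  -- The identity `ω ϑ q = m g` removes the proposal: each component of the instrumental mixture
  -- contributes its share of the mixture `∑ W_i m(ξ_i, x) g(x) ν(dx)`.
  have hterm : ∀ i : Fin N, Q.realWeight y ξ I ω t i * Q.ϑ (t + 1) (ξ t i ω) /
      (∑ l, Q.realWeight y ξ I ω t l * Q.ϑ (t + 1) (ξ t l ω)) *
      ∫ x, (Q.q (t + 1) (ξ t i ω) x : ℝ) * ((Q.weightFun y (t + 1) (ξ t i ω) x).toReal *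
        S.nextMean (fun s i => ξ s i ω) (Q.realWeight y ξ I ω) t f x) ∂S.ν
      = (∑ l, Q.realWeight y ξ I ω t l * Q.ϑ (t + 1) (ξ t l ω))⁻¹ *
        ∫ x, Q.realWeight y ξ I ω t i * ((S.m (ξ t i ω) x : ℝ) * S.g x (y (t + 1)) *
          S.nextMean (fun s i => ξ s i ω) (Q.realWeight y ξ I ω) t f x) ∂S.ν := by
    intro i
    rw [div_eq_inv_mul, mul_assoc, ← integral_const_mul]
    congr 1
    refine integral_congr_ae (ae_of_all _ fun x => ?_)
    simp only
    rw [← toReal_weightFun_mul (hK (t + 1) (by omega) htT (ξ t i ω) x)]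
    ring
  rw [Finset.sum_congr rfl fun i _ => hterm i, ← Finset.mul_sum, hsum]
  unfold StateSpaceModel.particleMean
  have := hW t le_rfl
  field_simp

end AuxiliaryProposal

/-! ### A deterministic ratio estimate and the normalised smoothing recursion. -/

/-- Multiply numerator and denominator by `τ`. Then `τ * A` is within `ε * M * β / 4` of `β * r` and
`τ * B` within `ε * β / 4` of `β`. So `τ * B > β / 2`, and `τ * A - r * (τ * B)` is below `ε * M * β
/ 2`. Only an upper bound on `τ` is needed, as it merely scales the errors of `A` and `B`. -/
theorem abs_div_sub_lt_of_close {A B a b τ β r M ε κ : ℝ} (hM : 0 < M) (hε : 0 < ε) (hε1 : ε ≤ 1)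
    (hβ : 0 < β) (hκ : 0 < κ) (hτ : 0 ≤ τ) (hτκ : τ ≤ κ) (hr : |r| ≤ M)
    (hA : |A - a| < ε * M * β / (8 * κ)) (hB : |B - b| < ε * β / (8 * κ))
    (ha : |τ * a - β * r| < ε * M * β / 8) (hb : |τ * b - β| < ε * β / 8) :
    0 < B ∧ |A / B - r| < ε * M := by
  have hA' : τ * |A - a| ≤ ε * M * β / 8 := by
    calc τ * |A - a| ≤ κ * (ε * M * β / (8 * κ)) := by gcongr
      _ = _ := by field_simp
  have hB' : τ * |B - b| ≤ ε * β / 8 := by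
    calc τ * |B - b| ≤ κ * (ε * β / (8 * κ)) := by gcongr
      _ = _ := by field_simp
  have h1 : |τ * A - β * r| < ε * M * β / 4 := by
    calc |τ * A - β * r| = |τ * (A - a) + (τ * a - β * r)| := by ring_nf
      _ ≤ τ * |A - a| + |τ * a - β * r| := by
        refine (abs_add_le _ _).trans ?_
        rw [abs_mul, abs_of_nonneg hτ]
      _ < _ := by linarith
  have h2 : |τ * B - β| < ε * β / 4 := by
    calc |τ * B - β| = |τ * (B - b) + (τ * b - β)| := by ring_nf
      _ ≤ τ * |B - b| + |τ * b - β| := by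
        refine (abs_add_le _ _).trans ?_
        rw [abs_mul, abs_of_nonneg hτ]
      _ < _ := by linarith
  have hεβ : ε * β ≤ β := by nlinarith
  have h3 : β / 2 < τ * B := by
    have := (abs_lt.1 h2).1
    linarith
  have hτB : 0 < τ * B := by linarith
  have hBpos : 0 < B := (pos_iff_pos_of_mul_pos hτB).1 (lt_of_le_of_ne hτ fun h => by simp [← h] at hτB)
  refine ⟨hBpos, ?_⟩
  have h4 : |τ * A - r * (τ * B)| < ε * M * β / 2 := by
    calc |τ * A - r * (τ * B)| = |(τ * A - β * r) + (-r) * (τ * B - β)| := by ring_nf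
      _ ≤ |τ * A - β * r| + |r| * |τ * B - β| := by
        refine (abs_add_le _ _).trans ?_
        rw [abs_mul, abs_neg]
      _ ≤ |τ * A - β * r| + M * (ε * β / 4) := by gcongr
      _ < _ := by linarith
  have h5 : A / B - r = (τ * A - r * (τ * B)) / (τ * B) := by
    have : τ ≠ 0 := fun h => by simp [h] at hτB
    field_simp
  rw [h5, abs_div, abs_of_pos hτB, div_lt_iff₀ hτB]
  calc _ < ε * M * (β / 2) := by linarith
    _ ≤ _ := by gcongr

theorem CondIIDOn.mono {Ω E ι : Type*} [Fintype ι] {F : MeasurableSpace Ω} [MeasurableSpace Ω]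
    [MeasurableSpace E] {P : Measure Ω} {G G' : Set Ω} {Z : ι → Ω → E} {κ : Ω → Measure E}
    (h : CondIIDOn P F G Z κ) (hG : G' ⊆ G) : CondIIDOn P F G' Z κ :=
  fun A hA hAG => h A hA (hAG.trans hG)

namespace StateSpaceModel

variable {X Y : Type*} [MeasurableSpace X] [MeasurableSpace Y] {S : StateSpaceModel X Y}
  {y : ℕ → Y} {t : ℕ}

theorem integral_one_pos {Kg : ℝ≥0} (hg : ∀ s ≤ t, ∀ x, 0 < S.g x (y s))
    (hKg : ∀ s ≤ t, ∀ x, S.g x (y s) ≤ Kg) : 0 < ∫ _x, (1 : ℝ) ∂S.unnormSmoothing y t := by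
  have := isFiniteMeasure_unnormSmoothing hKg
  rw [integral_const, smul_eq_mul, mul_one, Measure.real]
  exact ENNReal.toReal_pos (unnormSmoothing_univ_ne_zero hg) (measure_ne_top _ _)

theorem abs_smoothing_le {Kg : ℝ≥0} (hg : ∀ s ≤ t, ∀ x, 0 < S.g x (y s))
    (hKg : ∀ s ≤ t, ∀ x, S.g x (y s) ≤ Kg) {f : (Fin (t + 1) → X) → ℝ} {M : ℝ}
    (hfM : ∀ x, |f x| ≤ M) : |S.smoothing y t f| ≤ M := by
  have := isFiniteMeasure_unnormSmoothing hKg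
  have h1 := integral_one_pos hg hKg
  rw [smoothing, abs_div, abs_of_pos h1, div_le_iff₀ h1, ← integral_const_mul, mul_one]
  rw [← Real.norm_eq_abs]
  exact norm_integral_le_of_norm_le (integrable_const M) (ae_of_all _ hfM)

theorem smoothing_sub_const {Kg : ℝ≥0} (hg : ∀ s ≤ t, ∀ x, 0 < S.g x (y s))
    (hKg : ∀ s ≤ t, ∀ x, S.g x (y s) ≤ Kg) {f : (Fin (t + 1) → X) → ℝ} (hf : Measurable f) {M : ℝ}
    (hfM : ∀ x, |f x| ≤ M) (c : ℝ) :
    S.smoothing y t (fun x => f x - c) = S.smoothing y t f - c := by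
  have := isFiniteMeasure_unnormSmoothing hKg
  have h1 := integral_one_pos hg hKg
  have hint : Integrable f (S.unnormSmoothing y t) :=
    Integrable.of_bound hf.aestronglyMeasurable M (ae_of_all _ hfM)
  have hc : ∫ _x, c ∂S.unnormSmoothing y t = c * ∫ _x, (1 : ℝ) ∂S.unnormSmoothing y t := by
    rw [← integral_const_mul, mul_one]
  rw [smoothing, integral_sub hint (integrable_const c), hc, smoothing, sub_div,
    mul_div_cancel_right₀ _ h1.ne']

theorem smoothing_pathStep_one_pos {Kg : ℝ≥0} (hg : ∀ s ≤ t + 1, ∀ x, 0 < S.g x (y s))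
    (hKg : ∀ s ≤ t + 1, ∀ x, S.g x (y s) ≤ Kg) :
    0 < S.smoothing y t (S.pathStep y t fun _ => 1) := by
  rw [smoothing, ← integral_unnormSmoothing_succ hKg measurable_const (M := 1) (by simp)]
  exact div_pos (integral_one_pos hg hKg) (integral_one_pos (fun s hs => hg s (by omega))
    fun s hs => hKg s (by omega))

/-- The factor is the ratio of the normalising constants at times `t + 1` and `t`. -/
theorem smoothing_pathStep {Kg : ℝ≥0} (hg : ∀ s ≤ t + 1, ∀ x, 0 < S.g x (y s))
    (hKg : ∀ s ≤ t + 1, ∀ x, S.g x (y s) ≤ Kg) {f : (Fin (t + 2) → X) → ℝ} (hf : Measurable f)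
    {M : ℝ} (hfM : ∀ x, |f x| ≤ M) :
    S.smoothing y t (S.pathStep y t f)
      = S.smoothing y t (S.pathStep y t fun _ => 1) * S.smoothing y (t + 1) f := by
  have h1 := integral_one_pos hg hKg
  have h2 := integral_one_pos (fun s hs => hg s (by omega)) fun s (hs : s ≤ t) => hKg s (by omega)
  unfold smoothing
  rw [← integral_unnormSmoothing_succ hKg measurable_const (M := 1) (by simp),
    ← integral_unnormSmoothing_succ hKg hf hfM]
  field_simp

end StateSpaceModel

/-! ### Concentration of the forward particle estimate. -/

namespace AuxiliaryProposal

variable {X Y : Type*} [MeasurableSpace X] [MeasurableSpace Y] {S : StateSpaceModel X Y}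
  {Q : AuxiliaryProposal S} {y : ℕ → Y} {Ω : Type*} {N : ℕ}
  {ξ : ℕ → Fin N → Ω → X} {I : ℕ → Fin N → Ω → Fin N}

/-- The empirical mean of the weighted backward means of `f` at time `t`. -/
noncomputable def weightedMean (Q : AuxiliaryProposal S) (y : ℕ → Y) (ξ : ℕ → Fin N → Ω → X)
    (I : ℕ → Fin N → Ω → Fin N) (t : ℕ) (f : (Fin (t + 1) → X) → ℝ) (ω : Ω) : ℝ :=
  (N : ℝ)⁻¹ * ∑ i, Q.realWeight y ξ I ω t i * backwardMean (fun s i => ξ s i ω)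
    (S.backwardProb (fun s i => ξ s i ω) (Q.realWeight y ξ I ω)) t i f

/-- The particle estimate of the joint smoothing distribution. -/
noncomputable def estimate (Q : AuxiliaryProposal S) (y : ℕ → Y) (ξ : ℕ → Fin N → Ω → X)
    (I : ℕ → Fin N → Ω → Fin N) (t : ℕ) (f : (Fin (t + 1) → X) → ℝ) (ω : Ω) : ℝ :=
  S.particleMean (fun s i => ξ s i ω) (Q.realWeight y ξ I ω) t f

theorem weightedMean_div (hN : 0 < N) {t : ℕ} {ω : Ω}
    (hW : ∀ s < t, ∑ i, Q.realWeight y ξ I ω s i ≠ 0)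
    (f : (Fin (t + 1) → X) → ℝ) :
    Q.weightedMean y ξ I t f ω / Q.weightedMean y ξ I t (fun _ => 1) ω
      = Q.estimate y ξ I t f ω := by
  have hN' : (N : ℝ) ≠ 0 := by exact_mod_cast hN.ne'
  unfold weightedMean estimate StateSpaceModel.particleMean
  rw [mul_div_mul_left _ _ (inv_ne_zero hN')]
  simp_rw [backwardMean_const (fun s hs => StateSpaceModel.sum_backwardProb (hW s hs)), mul_one]

theorem weightedMean_one {t : ℕ} {ω : Ω}
    (hW : ∀ s < t, ∑ i, Q.realWeight y ξ I ω s i ≠ 0) :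
    Q.weightedMean y ξ I t (fun _ => 1) ω = (N : ℝ)⁻¹ * ∑ i, Q.realWeight y ξ I ω t i := by
  unfold weightedMean
  simp_rw [backwardMean_const (fun s hs => StateSpaceModel.sum_backwardProb (hW s hs)), mul_one]

theorem measurable_weighted_nextMean {A : Type*} [MeasurableSpace A] {ξ : A → ℕ → Fin N → X}
    {W : A → ℕ → Fin N → ℝ} {t : ℕ} (hξ : ∀ s ≤ t, ∀ i, Measurable fun a => ξ a s i)
    (hW : ∀ s ≤ t, ∀ i, Measurable fun a => W a s i) {f : (Fin (t + 2) → X) → ℝ}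
    (hf : Measurable f) :
    Measurable (Function.uncurry fun (a : A) (z : Fin N × X) =>
      (Q.weightFun y (t + 1) (ξ a t z.1) z.2).toReal * S.nextMean (ξ a) (W a) t f z.2) := by
  have h0 : Measurable fun q : Fin N × A => ξ q.2 t q.1 :=
    measurable_from_prod_countable_right fun i => hξ t le_rfl i
  have h1 : Measurable fun q : A × (Fin N × X) => ξ q.1 t q.2.1 :=
    h0.comp ((measurable_fst.comp measurable_snd).prodMk measurable_fst)
  have hs : Measurable fun q : A × (Fin N × X) => q.2.2 := measurable_snd.comp measurable_snd
  have h2 : Measurable fun q : A × (Fin N × X) =>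
      (Q.weightFun y (t + 1) (ξ q.1 t q.2.1) q.2.2).toReal :=
    ENNReal.measurable_toReal.comp ((Q.measurable_weightFun y (t + 1)).comp (h1.prodMk hs))
  have h3 : Measurable fun q : A × (Fin N × X) => S.nextMean (ξ q.1) (W q.1) t f q.2.2 :=
    (StateSpaceModel.measurable_nextMean hξ hW hf).comp (measurable_fst.prodMk hs)
  exact h2.mul h3

/-- Given the history at `t`, each summand is one fixed function of the pair (index, particle),
bounded by `K * M`, so conditional Hoeffding applies with the mean found in `integral_instrumental`.
-/
theorem measure_weightedMean_sub_ge_le [MeasurableSpace Ω] {P : Measure Ω} [IsProbabilityMeasure P]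
    {T t : ℕ} {J : Fin N → Ω → (Fin (T + 1) → Fin N)} (hN : 0 < N)
    (hI : Q.IsFFBSi y T P ξ I J) {K Kg : ℝ≥0} (hK0 : 0 < K)
    (hK : ∀ t, 1 ≤ t → t ≤ T → ∀ x x', Q.weightFun y t x x' ≤ K)
    (hg : ∀ s ≤ T, ∀ x, 0 < S.g x (y s)) (hKg : ∀ s ≤ T, ∀ x, S.g x (y s) ≤ Kg) (htT : t < T)
    {f : (Fin (t + 2) → X) → ℝ} (hf : Measurable f) {M : ℝ} (hM : 0 < M) (hfM : ∀ x, |f x| ≤ M)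
    {δ : ℝ} (hδ : 0 ≤ δ) :
    P {ω | ω ∈ Q.regularEvent y ξ I K t ∧ δ ≤ |Q.weightedMean y ξ I (t + 1) f ω -
        (∑ i, Q.realWeight y ξ I ω t i) /
          (∑ i, Q.realWeight y ξ I ω t i * Q.ϑ (t + 1) (ξ t i ω)) *
        Q.estimate y ξ I t (S.pathStep y t f) ω|}
      ≤ ENNReal.ofReal (2 * Real.exp (-(N * δ ^ 2 / (2 * (K * M) ^ 2)))) := by
  have hF := history_le (Q := Q) (y := y) hI.measurable_ξ hI.measurable_I htT.le
  have hcond := (hI.forward t htT).mono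
    (fun ω (hω : ω ∈ Q.regularEvent y ξ I K t) => hω.1)
  have hpart := fun s (hs : s ≤ t) i => Q.measurable_history_particle y ξ I hs i
  have hrw := fun s (hs : s ≤ t) i => Q.measurable_history_realWeight y ξ I hs i
  have hΨ := @measurable_weighted_nextMean X Y _ _ S Q y N Ω (Q.history y ξ I t)
    (fun ω s i => ξ s i ω) (Q.realWeight y ξ I) t hpart hrw f hf
  have ha : Measurable[Q.history y ξ I t] fun ω => (∑ i, Q.realWeight y ξ I ω t i) /
          (∑ i, Q.realWeight y ξ I ω t i * Q.ϑ (t + 1) (ξ t i ω)) *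
        Q.estimate y ξ I t (S.pathStep y t f) ω := by
    refine Measurable.mul (Measurable.div (Finset.measurable_sum _ fun i _ => hrw t le_rfl i)
      (Finset.measurable_sum _ fun i _ => (hrw t le_rfl i).mul
        ((Q.measurable_ϑ (t + 1)).coe_nnreal_real.comp (hpart t le_rfl i)))) ?_
    exact @StateSpaceModel.measurable_particleMean X Y _ _ S N Ω (Q.history y ξ I t)
      (fun ω s i => ξ s i ω) (Q.realWeight y ξ I) t hpart hrw _
      (StateSpaceModel.measurable_pathStep t hf)
  have key := hcond.measure_abs_mean_sub_integral_ge_le hN hF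
    (Q.measurableSet_regularEvent y ξ I K t)
    (fun i => (hI.measurable_I (t + 1) (by omega) htT i).prodMk (hI.measurable_ξ (t + 1) htT i))
    (fun B hB => measurable_instrumental_apply t hB)
    (fun ω hω => instrumental_univ hK hg htT hω) hΨ ha (M := K * M) (by positivity)
    (fun ω hω z => abs_weightFun_mul_le (hK (t + 1) (by omega) htT)
      (StateSpaceModel.abs_nextMean_le (fun s i => realWeight_nonneg ω s i)
        (fun s hs => sum_realWeight_ne_zero hK htT.le hω hs) hfM z.2) _ _)
    (fun ω hω => integral_instrumental hK hg hKg htT hω hf hfM) hδ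
  -- The weight and the backward mean at time `t + 1` unfold to `weightFun` and `nextMean` at the
  -- new particle.
  exact key

end AuxiliaryProposal

namespace AuxiliaryProposal

variable {X Y : Type*} [MeasurableSpace X] [MeasurableSpace Y] {S : StateSpaceModel X Y}
  {Q : AuxiliaryProposal S} {y : ℕ → Y} {Ω : Type*} {N : ℕ}
  {ξ : ℕ → Fin N → Ω → X} {I : ℕ → Fin N → Ω → Fin N}

/-- A change of measure from `init` to `ρ₀`. The weight is truncated at `K` because it is bounded
only almost everywhere, whereas the Hoeffding bound asks for a bound at every point. -/
theorem integral_unnormSmoothing_zero {K : ℝ≥0} (hK₀ : ∀ᵐ x ∂Q.ρ₀, Q.weightFun₀ y x ≤ K)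
    {f : (Fin 1 → X) → ℝ} (hf : Measurable f) :
    ∫ x, f x ∂S.unnormSmoothing y 0
      = ∫ x, (min (Q.weightFun₀ y x) K).toReal * f (fun _ => x) ∂Q.ρ₀ := by
  have := S.isProb_init
  have := Q.isProb_ρ₀
  have hm : Measurable fun (x : X) (_ : Fin 1) => x := measurable_pi_iff.2 fun _ => measurable_id
  have hgm := (S.measurable_g_right (y 0)).coe_nnreal_ennreal
  have e : S.init.withDensity (fun x => (S.g x (y 0) : ℝ≥0∞))
      = Q.ρ₀.withDensity (Q.weightFun₀ y) := by
    conv_lhs => rw [← Measure.withDensity_rnDeriv_eq S.init Q.ρ₀ Q.init_ac]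
    exact (withDensity_mul _ (Measure.measurable_rnDeriv _ _) hgm).symm
  rw [S.unnormSmoothing_zero, integral_map hm.aemeasurable hf.aestronglyMeasurable, e,
    integral_withDensity_eq_integral_toReal_smul (Q.measurable_weightFun₀ y)
      (hK₀.mono fun x hx => hx.trans_lt ENNReal.coe_lt_top)]
  refine integral_congr_ae (hK₀.mono fun x hx => ?_)
  simp only [smul_eq_mul]
  rw [min_eq_left hx]

theorem measure_initial_weight_gt_eq_zero [MeasurableSpace Ω] {P : Measure Ω}
    {T : ℕ} {J : Fin N → Ω → (Fin (T + 1) → Fin N)}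
    (hI : Q.IsFFBSi y T P ξ I J) {K : ℝ≥0} (hK₀ : ∀ᵐ x ∂Q.ρ₀, Q.weightFun₀ y x ≤ K) :
    P {ω | ¬ ∀ i, Q.weight y ξ I 0 i ω ≤ K} = 0 := by
  have : ∀ᵐ ω ∂P, ∀ i, Q.weight y ξ I 0 i ω ≤ K := by
    rw [ae_all_iff]
    intro i
    rw [← hI.initial_law i] at hK₀
    exact ae_of_ae_map (hI.measurable_ξ 0 (Nat.zero_le _) i).aemeasurable hK₀
  exact this

theorem measure_initial_weightedMean_sub_ge_le [MeasurableSpace Ω] {P : Measure Ω}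
    [IsProbabilityMeasure P] {T : ℕ} {J : Fin N → Ω → (Fin (T + 1) → Fin N)} (hN : 0 < N)
    (hI : Q.IsFFBSi y T P ξ I J) {K : ℝ≥0} (hK0 : 0 < K)
    (hK₀ : ∀ᵐ x ∂Q.ρ₀, Q.weightFun₀ y x ≤ K)
    {f : (Fin 1 → X) → ℝ} (hf : Measurable f) {M : ℝ} (hM : 0 < M) (hfM : ∀ x, |f x| ≤ M)
    {δ : ℝ} (hδ : 0 ≤ δ) :
    P {ω | (∀ i, Q.weight y ξ I 0 i ω ≤ K) ∧ δ ≤ |Q.weightedMean y ξ I 0 f ω -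
        ∫ x, f x ∂S.unnormSmoothing y 0|}
      ≤ ENNReal.ofReal (2 * Real.exp (-(N * δ ^ 2 / (2 * (K * M) ^ 2)))) := by
  have := Q.isProb_ρ₀
  have hξ := hI.measurable_ξ 0 (Nat.zero_le _)
  have hm : Measurable fun (x : X) (_ : Fin 1) => x := measurable_pi_iff.2 fun _ => measurable_id
  have hΦ : Measurable fun x => (min (Q.weightFun₀ y x) K).toReal * f (fun _ => x) :=
    (ENNReal.measurable_toReal.comp ((Q.measurable_weightFun₀ y).min measurable_const)).mul
      (hf.comp hm)
  have hΦM : ∀ x, |(min (Q.weightFun₀ y x) K).toReal * f (fun _ => x)| ≤ K * M := by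
    intro x
    rw [abs_mul, abs_of_nonneg ENNReal.toReal_nonneg]
    exact mul_le_mul (ENNReal.toReal_mono ENNReal.coe_ne_top (min_le_right _ _)) (hfM _)
      (abs_nonneg _) K.coe_nonneg
  have hmap : P.map (fun ω i => ξ 0 i ω) = Measure.pi fun _ : Fin N => Q.ρ₀ := by
    rw [(iIndepFun_iff_map_fun_eq_pi_map fun i => (hξ i).aemeasurable).1 hI.initial_indep]
    congr 1
    funext i
    exact hI.initial_law i
  have h := measure_pi_abs_mean_sub_integral_ge_le hN Q.ρ₀ hΦ (M := K * M) (by positivity) hΦM hδ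
  rw [← integral_unnormSmoothing_zero hK₀ hf, ← hmap] at h
  refine le_trans ?_ ((Measure.le_map_apply (measurable_pi_iff.2 hξ).aemeasurable _).trans h)
  refine measure_mono fun ω hω => ?_
  have h2 := hω.2
  simp only [weightedMean, backwardMean, realWeight] at h2
  simp only [Set.mem_preimage, Set.mem_ofPred_eq]
  convert h2 using 6 with i
  rw [min_eq_left (show Q.weightFun₀ y (ξ 0 i ω) ≤ K from hω.1 i)]
  rfl

theorem ofReal_exp_le_of_le {B a b : ℝ} (hB : 0 ≤ B) (hab : a ≤ b) :
    ENNReal.ofReal (B * Real.exp (-b)) ≤ ENNReal.ofReal (B * Real.exp (-a)) :=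
  ENNReal.ofReal_le_ofReal (mul_le_mul_of_nonneg_left (Real.exp_le_exp.2 (neg_le_neg hab)) hB)

/-- Exponential deviation inequality for the particle estimate of the joint smoothing
distribution of the states up to time `t`. -/
theorem exists_deviation_bound.{w} {T : ℕ} {K Kg κ : ℝ≥0} (hK0 : 0 < K) (hKg0 : 0 < Kg)
    (hκ0 : 0 < κ) (hK₀ : ∀ᵐ x ∂Q.ρ₀, Q.weightFun₀ y x ≤ K)
    (hK : ∀ t, 1 ≤ t → t ≤ T → ∀ x x', Q.weightFun y t x x' ≤ K)
    (hκ : ∀ t, 1 ≤ t → t ≤ T → ∀ x, Q.ϑ t x ≤ κ)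
    (hg : ∀ s ≤ T, ∀ x, 0 < S.g x (y s)) (hKg : ∀ s ≤ T, ∀ x, S.g x (y s) ≤ Kg)
    (t : ℕ) (htT : t ≤ T) :
    ∃ B C : ℝ, 0 < B ∧ 0 < C ∧ ∀ (N : ℕ), 0 < N → ∀ (Ω : Type w) [MeasurableSpace Ω]
      (P : Measure Ω) [IsProbabilityMeasure P] (ξ : ℕ → Fin N → Ω → X)
      (I : ℕ → Fin N → Ω → Fin N) (J : Fin N → Ω → (Fin (T + 1) → Fin N)),
      Q.IsFFBSi y T P ξ I J → ∀ f : (Fin (t + 1) → X) → ℝ, Measurable f → ∀ M : ℝ, 0 < M →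
      (∀ x, |f x| ≤ M) → ∀ ε : ℝ, 0 < ε → ε ≤ 1 →
      P {ω | ω ∈ Q.regularEvent y ξ I K t →
          ε * M ≤ |Q.estimate y ξ I t f ω - S.smoothing y t f|}
        ≤ ENNReal.ofReal (B * Real.exp (-(C * N * ε ^ 2))) := by
  -- The event is an implication, so it contains the complement of `regularEvent`: the induction
  -- carries the control of degeneracy along with that of the error.
  induction t with
  | zero =>
    have hg' : ∀ s ≤ 0, ∀ x, 0 < S.g x (y s) := fun s hs => hg s (by omega)
    have hKg' : ∀ s ≤ 0, ∀ x, S.g x (y s) ≤ Kg := fun s hs => hKg s (by omega)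
    set β := ∫ _x, (1 : ℝ) ∂S.unnormSmoothing y 0 with hβdef
    have hβ : 0 < β := StateSpaceModel.integral_one_pos hg' hKg'
    refine ⟨4, β ^ 2 / (128 * K ^ 2), by norm_num, by positivity, ?_⟩
    intro N hN Ω _ P _ ξ I J hI f hf M hM hfM ε hε hε1
    have hN' : (0 : ℝ) < N := by exact_mod_cast hN
    have h1 := measure_initial_weightedMean_sub_ge_le hN hI hK0 hK₀ hf hM hfM
      (δ := ε * M * β / (8 * 1)) (by positivity)
    have h2 := measure_initial_weightedMean_sub_ge_le hN hI hK0 hK₀ (f := fun _ => 1)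
      measurable_const one_pos (by simp) (δ := ε * β / (8 * 1)) (by positivity)
    have h3 := measure_initial_weight_gt_eq_zero hI hK₀
    calc _ ≤ P ({ω | ¬ ∀ i, Q.weight y ξ I 0 i ω ≤ K} ∪
            ({ω | (∀ i, Q.weight y ξ I 0 i ω ≤ K) ∧ ε * M * β / (8 * 1) ≤
              |Q.weightedMean y ξ I 0 f ω - ∫ x, f x ∂S.unnormSmoothing y 0|} ∪
            {ω | (∀ i, Q.weight y ξ I 0 i ω ≤ K) ∧ ε * β / (8 * 1) ≤
              |Q.weightedMean y ξ I 0 (fun _ => 1) ω -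
                ∫ x, (fun _ => (1 : ℝ)) x ∂S.unnormSmoothing y 0|})) := by
          refine measure_mono fun ω hω => ?_
          by_contra hcon
          simp only [Set.mem_union, Set.mem_ofPred_eq, not_or, not_not, not_and, not_le] at hcon
          obtain ⟨hc0, hc1, hc2⟩ := hcon
          have hr := StateSpaceModel.abs_smoothing_le hg' hKg' hfM
          have hβr : (1 : ℝ) * (∫ x, f x ∂S.unnormSmoothing y 0) - β * S.smoothing y 0 f = 0 := by
            rw [StateSpaceModel.smoothing, ← hβdef, one_mul, mul_div_assoc',
              mul_div_cancel_left₀ _ hβ.ne', sub_self]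
          obtain ⟨hB, hlt⟩ := abs_div_sub_lt_of_close (τ := 1) (β := β) hM hε hε1 hβ one_pos
            zero_le_one le_rfl hr (hc1 hc0) (hc2 hc0)
            (by rw [hβr, abs_zero]; positivity)
            (by rw [one_mul, ← hβdef, sub_self, abs_zero]; positivity)
          rw [weightedMean_div hN (by intro s hs; omega)] at hlt
          rw [weightedMean_one (by intro s hs; omega)] at hB
          refine absurd (hω ⟨fun s hs hsum => ?_, hc0⟩) (not_le.2 hlt)
          obtain rfl : s = 0 := by omega
          have : ∑ i, Q.realWeight y ξ I ω 0 i = 0 := by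
            refine Finset.sum_eq_zero fun i hi => ?_
            simp [realWeight, Finset.sum_eq_zero_iff.1 hsum i hi]
          simp [this] at hB
      _ ≤ 0 + (ENNReal.ofReal (2 * Real.exp (-(β ^ 2 / (128 * K ^ 2) * N * ε ^ 2))) +
            ENNReal.ofReal (2 * Real.exp (-(β ^ 2 / (128 * K ^ 2) * N * ε ^ 2)))) := by
          refine (measure_union_le _ _).trans (add_le_add h3.le ((measure_union_le _ _).trans
            (add_le_add (h1.trans (ofReal_exp_le_of_le zero_le_two (le_of_eq ?_)))
              (h2.trans (ofReal_exp_le_of_le zero_le_two (le_of_eq ?_))))))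
          · field_simp
            ring
          · field_simp
            ring
      _ = _ := by
          rw [zero_add, ← ENNReal.ofReal_add (by positivity) (by positivity)]
          congr 1
          ring
  | succ t ih =>
    obtain ⟨B, C, hB, hC, hBC⟩ := ih (by omega)
    have hg' : ∀ s ≤ t + 1, ∀ x, 0 < S.g x (y s) := fun s hs => hg s (by omega)
    have hKg' : ∀ s ≤ t + 1, ∀ x, S.g x (y s) ≤ Kg := fun s hs => hKg s (by omega)
    set β := S.smoothing y t (S.pathStep y t fun _ => 1) with hβdef
    have hβ : 0 < β := StateSpaceModel.smoothing_pathStep_one_pos hg' hKg'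
    have hβKg : β ≤ Kg := by
      have := StateSpaceModel.abs_smoothing_le (fun s hs => hg' s (by omega))
        (fun s hs => hKg' s (by omega)) (StateSpaceModel.abs_pathStep_le (S := S) (y := y)
          (hKg' (t + 1) le_rfl) (f := fun _ => 1) (M := 1) (by simp))
      rw [mul_one] at this
      exact (le_abs_self _).trans this
    have hKgr : (0 : ℝ) < Kg := by exact_mod_cast hKg0
    have hκr : (0 : ℝ) < κ := by exact_mod_cast hκ0
    have hKr : (0 : ℝ) < K := by exact_mod_cast hK0
    -- Two uses of the induction hypothesis give `2 * B`, two of Hoeffding give `4`. The rates come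
    -- from accuracy `ε * β / (8 * Kg)` in the former and `δ = ε * M * β / (8 * κ)`, with summands
    -- bounded by `K * M`, in the latter.
    refine ⟨2 * B + 4, min (C * β ^ 2 / (64 * Kg ^ 2)) (β ^ 2 / (128 * κ ^ 2 * K ^ 2)),
      by positivity, by positivity, ?_⟩
    intro N hN Ω _ P _ ξ I J hI f hf M hM hfM ε hε hε1
    have hN' : (0 : ℝ) < N := by exact_mod_cast hN
    set C' := min (C * β ^ 2 / (64 * Kg ^ 2)) (β ^ 2 / (128 * κ ^ 2 * K ^ 2)) with hC'
    have hε' : ε * β / (8 * Kg) ≤ 1 := by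
      rw [div_le_one (by positivity)]
      nlinarith
    have h1 := measure_weightedMean_sub_ge_le hN hI hK0 hK hg hKg htT hf hM hfM
      (δ := ε * M * β / (8 * κ)) (by positivity)
    have h2 := measure_weightedMean_sub_ge_le hN hI hK0 hK hg hKg htT (f := fun _ => 1)
      measurable_const one_pos (by simp) (δ := ε * β / (8 * κ)) (by positivity)
    -- `pathStep f` is bounded by `Kg * M`, so this relative accuracy means an absolute error `ε * M
    -- * β / 8`, as the ratio estimate requires.
    have h3 := hBC N hN Ω P ξ I J hI (S.pathStep y t f) (StateSpaceModel.measurable_pathStep t hf)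
      (Kg * M) (by positivity) (StateSpaceModel.abs_pathStep_le (hKg' (t + 1) le_rfl) hfM)
      (ε * β / (8 * Kg)) (by positivity) hε'
    have h4 := hBC N hN Ω P ξ I J hI (S.pathStep y t fun _ => 1)
      (StateSpaceModel.measurable_pathStep t measurable_const)
      (Kg * 1) (by positivity) (StateSpaceModel.abs_pathStep_le (hKg' (t + 1) le_rfl) (by simp))
      (ε * β / (8 * Kg)) (by positivity) hε'
    have e1 : C' * N * ε ^ 2 ≤ C * N * (ε * β / (8 * Kg)) ^ 2 := by
      calc C' * N * ε ^ 2 ≤ (C * β ^ 2 / (64 * Kg ^ 2)) * N * ε ^ 2 := by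
            gcongr
            exact min_le_left _ _
        _ = _ := by
            field_simp
            ring
    have e2 : C' * N * ε ^ 2 ≤ N * (ε * M * β / (8 * κ)) ^ 2 / (2 * (K * M) ^ 2) := by
      calc C' * N * ε ^ 2 ≤ (β ^ 2 / (128 * κ ^ 2 * K ^ 2)) * N * ε ^ 2 := by
            gcongr
            exact min_le_right _ _
        _ = _ := by
            field_simp
            ring
    have e3 : C' * N * ε ^ 2 ≤ N * (ε * β / (8 * κ)) ^ 2 / (2 * (K * 1) ^ 2) := by
      calc C' * N * ε ^ 2 ≤ (β ^ 2 / (128 * κ ^ 2 * K ^ 2)) * N * ε ^ 2 := by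
            gcongr
            exact min_le_right _ _
        _ = _ := by
            field_simp
            ring
    refine le_trans ?_ ((measure_union_le _ _).trans (add_le_add
      ((measure_union_le _ _).trans (add_le_add (h3.trans (ofReal_exp_le_of_le hB.le e1))
        (h4.trans (ofReal_exp_le_of_le hB.le e1))))
      ((measure_union_le _ _).trans (add_le_add (h1.trans (ofReal_exp_le_of_le zero_le_two e2))
        (h2.trans (ofReal_exp_le_of_le zero_le_two e3)))))) |>.trans (le_of_eq ?_)
    · refine measure_mono fun ω hω => ?_
      by_contra hcon
      simp only [Set.mem_union, Set.mem_ofPred_eq, not_or, not_and, not_le, Classical.not_imp]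
        at hcon
      obtain ⟨⟨⟨hω', hc1⟩, -, hc2⟩, hc3, hc4⟩ := hcon
      replace hc3 := hc3 hω'
      replace hc4 := hc4 hω'
      have hr := StateSpaceModel.abs_smoothing_le hg' hKg' hfM
      have hWn := fun s (hs : s ≤ t) => sum_realWeight_ne_zero hK (by omega) hω' hs
      have hWpos : 0 < ∑ i, Q.realWeight y ξ I ω t i :=
        lt_of_le_of_ne (Finset.sum_nonneg fun i _ => realWeight_nonneg ω t i) (hWn t le_rfl).symm
      have hVnn : 0 ≤ ∑ i, Q.realWeight y ξ I ω t i * Q.ϑ (t + 1) (ξ t i ω) :=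
        Finset.sum_nonneg fun i _ => mul_nonneg (realWeight_nonneg ω t i) (NNReal.coe_nonneg _)
      have hVne : ∑ i, Q.realWeight y ξ I ω t i * (Q.ϑ (t + 1) (ξ t i ω) : ℝ) ≠ 0 := by
        intro h0
        refine hWn t le_rfl (Finset.sum_eq_zero fun i hi => ?_)
        have := (Finset.sum_eq_zero_iff_of_nonneg fun i _ =>
          mul_nonneg (realWeight_nonneg ω t i) (NNReal.coe_nonneg _)).1 h0 i hi
        refine (mul_eq_zero.1 this).resolve_right (NNReal.coe_ne_zero.2 ?_)
        exact (ϑ_pos (hK (t + 1) (by omega) htT) (hg (t + 1) htT) (ξ t i ω)).ne'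
      have hVle : ∑ i, Q.realWeight y ξ I ω t i * (Q.ϑ (t + 1) (ξ t i ω) : ℝ)
          ≤ κ * ∑ i, Q.realWeight y ξ I ω t i := by
        rw [Finset.mul_sum]
        refine Finset.sum_le_sum fun i _ => ?_
        rw [mul_comm]
        exact mul_le_mul_of_nonneg_right (hκ (t + 1) (by omega) htT _) (realWeight_nonneg ω t i)
      set s₁ := ∑ i, Q.realWeight y ξ I ω t i
      set s₂ := ∑ i, Q.realWeight y ξ I ω t i * (Q.ϑ (t + 1) (ξ t i ω) : ℝ)
      -- The random factor is `τ = s₂ / s₁`, a weighted average of the multipliers, hence at most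
      -- `κ`.
      have hcancel : ∀ a : ℝ, s₂ / s₁ * (s₁ / s₂ * a) = a := fun a => by
        field_simp
      obtain ⟨hBp, hlt⟩ := abs_div_sub_lt_of_close (τ := s₂ / s₁) (β := β) hM hε hε1 hβ hκr
        (div_nonneg hVnn hWpos.le) ((div_le_iff₀ hWpos).2 hVle) hr hc3 hc4
        (by
          rw [hcancel, ← StateSpaceModel.smoothing_pathStep hg' hKg' hf hfM]
          refine hc1.trans_eq ?_
          field_simp)
        (by
          rw [hcancel]
          refine hc2.trans_eq ?_
          field_simp)
      rw [weightedMean_div hN (fun s hs => hWn s (by omega))] at hlt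
      rw [weightedMean_one (fun s hs => hWn s (by omega))] at hBp
      -- Outside the four exceptional events the error is small, so only membership in
      -- `regularEvent` at `t + 1` is left; positivity of the empirical denominator supplies it.
      refine absurd (hω ⟨fun s hs hsum => ?_, hω'.2⟩) (not_le.2 hlt)
      rcases Nat.lt_or_ge t s with hts | hts
      · obtain rfl : s = t + 1 := by omega
        have : ∑ i, Q.realWeight y ξ I ω (t + 1) i = 0 := by
          refine Finset.sum_eq_zero fun i hi => ?_
          simp [realWeight, Finset.sum_eq_zero_iff.1 hsum i hi]
        simp [this] at hBp
      · exact hω'.1 s hts hsum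
    · rw [← ENNReal.ofReal_add (by positivity) (by positivity),
        ← ENNReal.ofReal_add (by positivity) (by positivity),
        ← ENNReal.ofReal_add (by positivity) (by positivity)]
      congr 1
      ring

end AuxiliaryProposal

/-! ### The law of the backward index paths. -/

namespace AuxiliaryProposal

variable {X Y : Type*} [MeasurableSpace X] [MeasurableSpace Y] {S : StateSpaceModel X Y}
  {Q : AuxiliaryProposal S} {y : ℕ → Y} {Ω : Type*} {N : ℕ}
  {ξ : ℕ → Fin N → Ω → X} {I : ℕ → Fin N → Ω → Fin N}

/-- The probability of the backward index path `j`. -/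
noncomputable def pathProb (Q : AuxiliaryProposal S) (y : ℕ → Y) (ξ : ℕ → Fin N → Ω → X)
    (I : ℕ → Fin N → Ω → Fin N) (T : ℕ) (ω : Ω) (j : Fin (T + 1) → Fin N) : ℝ≥0∞ :=
  (Q.weight y ξ I T (j (Fin.last T)) ω / ∑ l, Q.weight y ξ I T l ω) *
    ∏ t : Fin T, Q.backwardMatrix y ξ I t ω (j t.succ) (j t.castSucc)

theorem backwardPathLaw_apply (T : ℕ) (ω : Ω) (B : Set (Fin (T + 1) → Fin N)) :
    Q.backwardPathLaw y ξ I T ω B = ∑ j, Q.pathProb y ξ I T ω j * Measure.dirac j B := by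
  simp [backwardPathLaw, pathProb]

theorem measurable_pathProb (T : ℕ) (j : Fin (T + 1) → Fin N) :
    Measurable[Q.history y ξ I T] fun ω => Q.pathProb y ξ I T ω j := by
  have hw := fun s (hs : s ≤ T) i => Q.measurable_history_weight y ξ I hs i
  have hx := fun s (hs : s ≤ T) i => Q.measurable_history_particle y ξ I hs i
  refine Measurable.mul ((hw T le_rfl _).div (Finset.measurable_sum _ fun l _ => hw T le_rfl l))
    (Finset.measurable_prod _ fun t _ => ?_)
  have h1 : ∀ l i, Measurable[Q.history y ξ I T] fun ω =>
      Q.weight y ξ I t l ω * (S.m (ξ t l ω) (ξ (t + 1) i ω) : ℝ≥0∞) := fun l i =>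
    (hw t (by omega) l).mul (measurable_coe_nnreal_ennreal.comp
      (S.measurable_m.comp ((hx t (by omega) l).prodMk (hx (t + 1) (by omega) i))))
  exact (h1 _ _).div (Finset.measurable_sum _ fun l _ => h1 l _)

theorem pathProb_ne_top (T : ℕ) (ω : Ω) (j : Fin (T + 1) → Fin N) :
    Q.pathProb y ξ I T ω j ≠ ∞ := by
  have hdiv : ∀ (a : Fin N → ℝ≥0∞) (i : Fin N), a i / ∑ l, a l ≤ 1 := fun a i =>
    (ENNReal.div_le_div_right (Finset.single_le_sum (fun _ _ => zero_le) (Finset.mem_univ i)) _).trans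
      ENNReal.div_self_le_one
  refine ENNReal.mul_ne_top ((hdiv (fun l => Q.weight y ξ I T l ω) _).trans_lt
    ENNReal.one_lt_top).ne (ENNReal.prod_ne_top fun t _ => ?_)
  exact ((hdiv (fun l => Q.weight y ξ I t l ω * S.m (ξ t l ω) (ξ (t + 1) (j t.succ) ω)) _).trans_lt
    ENNReal.one_lt_top).ne

/-- `pathProb` with the backward probabilities extended to unreachable states. -/
noncomputable def extendedPathProb (Q : AuxiliaryProposal S) (y : ℕ → Y) (ξ : ℕ → Fin N → Ω → X)
    (I : ℕ → Fin N → Ω → Fin N) (T : ℕ) (ω : Ω) (j : Fin (T + 1) → Fin N) : ℝ :=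
  Q.realWeight y ξ I ω T (j (Fin.last T)) / (∑ l, Q.realWeight y ξ I ω T l) *
    ∏ t : Fin T, S.backwardProb (fun s i => ξ s i ω) (Q.realWeight y ξ I ω) t
      (j t.succ) (j t.castSucc)

theorem sum_extendedPathProb_mul (T : ℕ) (ω : Ω) (f : (Fin (T + 1) → X) → ℝ) :
    ∑ j, Q.extendedPathProb y ξ I T ω j * f (fun s => ξ s (j s) ω) = Q.estimate y ξ I T f ω := by
  have h := sum_prod_mul_eq_sum_backwardMean (ξ := fun s i => ξ s i ω)
    (L := S.backwardProb (fun s i => ξ s i ω) (Q.realWeight y ξ I ω)) T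
    (fun i => Q.realWeight y ξ I ω T i / ∑ l, Q.realWeight y ξ I ω T l) f
  refine h.trans ?_
  unfold estimate StateSpaceModel.particleMean
  rw [Finset.sum_div]
  exact Finset.sum_congr rfl fun i _ => by rw [div_mul_eq_mul_div]

theorem sum_extendedPathProb {K : ℝ≥0} {T : ℕ}
    (hK : ∀ t, 1 ≤ t → t ≤ T → ∀ x x', Q.weightFun y t x x' ≤ K)
    {ω : Ω} (hω : ω ∈ Q.regularEvent y ξ I K T) : ∑ j, Q.extendedPathProb y ξ I T ω j = 1 := by
  have h := sum_extendedPathProb_mul (Q := Q) (y := y) (ξ := ξ) (I := I) T ω fun _ => 1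
  have hW := fun s hs => sum_realWeight_ne_zero hK le_rfl hω (s := s) hs
  simp only [mul_one] at h
  rw [h]
  unfold estimate StateSpaceModel.particleMean
  simp_rw [backwardMean_const (fun s hs => StateSpaceModel.sum_backwardProb (hW s (le_of_lt hs))),
    mul_one]
  exact div_self (hW T le_rfl)

/-- The two differ only in rows of the form `0 / 0`, which are zero in the algorithm's matrix and
probability vectors in the extension. -/
theorem toReal_pathProb_le {K : ℝ≥0} {T : ℕ}
    (hK : ∀ t, 1 ≤ t → t ≤ T → ∀ x x', Q.weightFun y t x x' ≤ K)
    {ω : Ω} (hω : ω ∈ Q.regularEvent y ξ I K T) (j : Fin (T + 1) → Fin N) :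
    (Q.pathProb y ξ I T ω j).toReal ≤ Q.extendedPathProb y ξ I T ω j := by
  have hw : ∀ s ≤ T, ∀ i, Q.weight y ξ I s i ω ≠ ∞ := fun s hs i =>
    ((weight_le hK hω hs i).trans_lt ENNReal.coe_lt_top).ne
  unfold pathProb extendedPathProb
  rw [ENNReal.toReal_mul, ENNReal.toReal_div, ENNReal.toReal_prod,
    ← sum_realWeight hK hω le_rfl]
  refine mul_le_mul_of_nonneg_left (Finset.prod_le_prod (fun _ _ => ENNReal.toReal_nonneg)
    fun t _ => ?_) (div_nonneg ENNReal.toReal_nonneg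
      (Finset.sum_nonneg fun i _ => realWeight_nonneg ω T i))
  have ht : (t : ℕ) ≤ T := by omega
  refine le_trans (le_of_eq ?_) (div_le_reweight (w := Q.realWeight y ξ I ω t)
    (c := fun l => (S.m (ξ t l ω) (ξ (t + 1) (j t.succ) ω) : ℝ))
    (fun i => realWeight_nonneg ω t i) (fun _ => NNReal.coe_nonneg _) (j t.castSucc))
  rw [backwardMatrix, ENNReal.toReal_div, ENNReal.toReal_sum fun l _ => ENNReal.mul_ne_top
    (hw t ht l) ENNReal.coe_ne_top]
  simp [ENNReal.toReal_mul, realWeight]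

theorem backwardPathLaw_univ (T : ℕ) (ω : Ω) :
    Q.backwardPathLaw y ξ I T ω Set.univ = ∑ j, Q.pathProb y ξ I T ω j := by
  simp [backwardPathLaw_apply]

theorem toReal_sum_pathProb (T : ℕ) (ω : Ω) :
    (∑ j, Q.pathProb y ξ I T ω j).toReal = ∑ j, (Q.pathProb y ξ I T ω j).toReal :=
  ENNReal.toReal_sum fun j _ => pathProb_ne_top T ω j

theorem backwardPathLaw_univ_le_one {K : ℝ≥0} {T : ℕ}
    (hK : ∀ t, 1 ≤ t → t ≤ T → ∀ x x', Q.weightFun y t x x' ≤ K)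
    {ω : Ω} (hω : ω ∈ Q.regularEvent y ξ I K T) :
    Q.backwardPathLaw y ξ I T ω Set.univ ≤ 1 := by
  rw [backwardPathLaw_univ, ← ENNReal.ofReal_toReal
    (ENNReal.sum_lt_top.2 fun j _ => (pathProb_ne_top T ω j).lt_top).ne, toReal_sum_pathProb]
  refine ENNReal.ofReal_le_one.2 ?_
  rw [← sum_extendedPathProb hK hω]
  exact Finset.sum_le_sum fun j _ => toReal_pathProb_le hK hω j

/-- The true path probabilities lie termwise below the extended ones, which sum to one. If the true
law also has mass one, the two coincide, and the mean is the smoothing estimate. -/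
theorem integral_backwardPathLaw {K : ℝ≥0} {T : ℕ}
    (hK : ∀ t, 1 ≤ t → t ≤ T → ∀ x x', Q.weightFun y t x x' ≤ K)
    {ω : Ω} (hω : ω ∈ Q.regularEvent y ξ I K T)
    (hω1 : Q.backwardPathLaw y ξ I T ω Set.univ = 1) (f : (Fin (T + 1) → X) → ℝ) :
    ∫ j, f (fun s => ξ s (j s) ω) ∂Q.backwardPathLaw y ξ I T ω = Q.estimate y ξ I T f ω := by
  have hle := fun j (_ : j ∈ Finset.univ) => toReal_pathProb_le hK hω j
  have heq : ∀ j, (Q.pathProb y ξ I T ω j).toReal = Q.extendedPathProb y ξ I T ω j := by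
    have := (Finset.sum_eq_sum_iff_of_le hle).1 (by
      rw [sum_extendedPathProb hK hω, ← toReal_sum_pathProb, ← backwardPathLaw_univ, hω1,
        ENNReal.toReal_one])
    exact fun j => this j (Finset.mem_univ j)
  rw [← sum_extendedPathProb_mul]
  change ∫ j, f (fun s => ξ s (j s) ω) ∂(∑ j, Q.pathProb y ξ I T ω j • Measure.dirac j) = _
  rw [integral_finsetSum_measure fun j _ =>
    (integrable_dirac (by simp)).smul_measure (pathProb_ne_top T ω j)]
  refine Finset.sum_congr rfl fun j _ => ?_
  rw [integral_smul_measure, integral_dirac, heq, smul_eq_mul]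

theorem measure_ffbsiEstimator_sub_estimate_ge_le [MeasurableSpace Ω] {P : Measure Ω}
    [IsProbabilityMeasure P] {T : ℕ} {J : Fin N → Ω → (Fin (T + 1) → Fin N)} (hN : 0 < N)
    (hI : Q.IsFFBSi y T P ξ I J) {K : ℝ≥0}
    (hK : ∀ t, 1 ≤ t → t ≤ T → ∀ x x', Q.weightFun y t x x' ≤ K)
    {f : (Fin (T + 1) → X) → ℝ} (hf : Measurable f) {M : ℝ} (hM : 0 < M) (hfM : ∀ x, |f x| ≤ M)
    {δ : ℝ} (hδ : 0 ≤ δ) :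
    P {ω | ω ∈ Q.regularEvent y ξ I K T ∧
        δ ≤ |ffbsiEstimator ξ J f ω - Q.estimate y ξ I T f ω|}
      ≤ ENNReal.ofReal (2 * Real.exp (-(N * δ ^ 2 / (2 * M ^ 2)))) := by
  have : Nonempty (Fin N) := ⟨⟨0, hN⟩⟩
  have hF := history_le (Q := Q) (y := y) hI.measurable_ξ hI.measurable_I le_rfl
  have hpart := fun s (hs : s ≤ T) i => Q.measurable_history_particle y ξ I hs i
  have hrw := fun s (hs : s ≤ T) i => Q.measurable_history_realWeight y ξ I hs i
  have hκ : ∀ B, MeasurableSet B →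
      Measurable[Q.history y ξ I T] fun ω => Q.backwardPathLaw y ξ I T ω B := by
    intro B _
    simp_rw [backwardPathLaw_apply]
    exact Finset.measurable_sum _ fun j _ => (measurable_pathProb T j).mul_const _
  have hcond : CondIIDOn P (Q.history y ξ I T) (Q.regularEvent y ξ I K T) J
      (Q.backwardPathLaw y ξ I T) := hI.backward.mono fun ω hω => hω.1
  have h0 := hcond.ae_mass_eq_one hF (Q.measurableSet_regularEvent y ξ I K T)
    (hκ _ MeasurableSet.univ) (fun ω hω => backwardPathLaw_univ_le_one hK hω)
  -- Hoeffding is applied where the path law is a probability measure; the rest of `regularEvent` is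
  -- null by `CondIIDOn.ae_mass_eq_one`.
  have hG : MeasurableSet[Q.history y ξ I T] (Q.regularEvent y ξ I K T ∩
      {ω | Q.backwardPathLaw y ξ I T ω Set.univ = 1}) :=
    (Q.measurableSet_regularEvent y ξ I K T).inter
      (hκ _ MeasurableSet.univ (measurableSet_singleton 1))
  have hΨ : Measurable[(Q.history y ξ I T).prod inferInstance]
      (Function.uncurry fun (ω : Ω) (j : Fin (T + 1) → Fin N) => f (fun s => ξ s (j s) ω)) :=
    measurable_from_prod_countable_left fun j =>
      hf.comp (@measurable_pi_lambda Ω _ _ (Q.history y ξ I T) _ _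
        fun s => hpart s (by omega) (j s))
  have h1 := (hcond.mono Set.inter_subset_left).measure_abs_mean_sub_integral_ge_le hN hF hG
    hI.measurable_J hκ (fun ω hω => hω.2) hΨ (a := Q.estimate y ξ I T f)
    (@StateSpaceModel.measurable_particleMean X Y _ _ S N Ω (Q.history y ξ I T)
      (fun ω s i => ξ s i ω) (Q.realWeight y ξ I) T hpart hrw f hf) hM (fun ω _ j => hfM _)
    (fun ω hω => integral_backwardPathLaw hK hω.1 hω.2 f) hδ
  refine le_trans (measure_mono fun ω hω => ?_) ((measure_union_le _ _).trans
    ((add_le_add h0.le h1).trans_eq (zero_add _)))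
  by_cases h : Q.backwardPathLaw y ξ I T ω Set.univ = 1
  · exact Or.inr ⟨⟨hω.1, h⟩, hω.2⟩
  · exact Or.inl ⟨hω.1, h⟩

end AuxiliaryProposal

/-! ### Reduction to the oscillation and conclusion. -/

theorem abs_sub_le_osc {E : Type*} {h : E → ℝ} (hb : ∃ K, ∀ x, |h x| ≤ K) (x x' : E) :
    |h x - h x'| ≤ osc h := by
  obtain ⟨K, hK⟩ := hb
  refine le_ciSup (f := fun p : E × E => |h p.1 - h p.2|) ⟨K + K, ?_⟩ (x, x')
  rintro _ ⟨p, rfl⟩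
  exact (abs_sub _ _).trans (add_le_add (hK _) (hK _))

theorem abs_sub_ffbsiEstimator_le_osc {X Ω : Type*} {N T : ℕ} (hN : 0 < N)
    (ξ : ℕ → Fin N → Ω → X) (J : Fin N → Ω → (Fin (T + 1) → Fin N)) {h : (Fin (T + 1) → X) → ℝ}
    (hb : ∃ K, ∀ x, |h x| ≤ K) (ω : Ω) (x : Fin (T + 1) → X) :
    |h x - ffbsiEstimator ξ J h ω| ≤ osc h := by
  have hN' : (0 : ℝ) < N := by exact_mod_cast hN
  have e : h x - ffbsiEstimator ξ J h ω
      = ∑ l, (N : ℝ)⁻¹ * (h x - h (fun t => ξ t (J l ω t) ω)) := by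
    rw [← Finset.mul_sum, Finset.sum_sub_distrib, mul_sub, Finset.sum_const, Finset.card_univ,
      Fintype.card_fin, nsmul_eq_mul, inv_mul_cancel_left₀ hN'.ne']
    rfl
  rw [e]
  exact abs_sum_mul_le (fun _ => (inv_pos.2 hN').le) (by simp [hN'.ne'])
    fun l => abs_sub_le_osc hb _ _

theorem ffbsiEstimator_sub_const {X Ω : Type*} {N T : ℕ} (hN : 0 < N)
    (ξ : ℕ → Fin N → Ω → X) (J : Fin N → Ω → (Fin (T + 1) → Fin N)) (h : (Fin (T + 1) → X) → ℝ)
    (c : ℝ) (ω : Ω) :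
    ffbsiEstimator ξ J (fun x => h x - c) ω = ffbsiEstimator ξ J h ω - c := by
  have hN' : (N : ℝ) ≠ 0 := by exact_mod_cast hN.ne'
  simp only [ffbsiEstimator, Finset.sum_sub_distrib, Finset.sum_const, Finset.card_univ,
    Fintype.card_fin, nsmul_eq_mul, mul_sub, inv_mul_cancel_left₀ hN']

theorem mainTheorem5 {X Y : Type*}
    [TopologicalSpace X] [PolishSpace X] [MeasurableSpace X] [BorelSpace X]
    [TopologicalSpace Y] [PolishSpace Y] [MeasurableSpace Y] [BorelSpace Y]
    (S : StateSpaceModel X Y) (Q : AuxiliaryProposal S) (y : ℕ → Y) (T : ℕ)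
    (hS : S.LikelihoodBounded y T) (hQ : Q.WeightsBounded y T) :
    ∃ B C : ℝ, 0 < B ∧ 0 < C ∧
      ∀ (N : ℕ), 0 < N →
      ∀ (Ω : Type*) [MeasurableSpace Ω] (P : Measure Ω) [IsProbabilityMeasure P]
        (ξ : ℕ → Fin N → Ω → X) (I : ℕ → Fin N → Ω → Fin N)
        (J : Fin N → Ω → (Fin (T + 1) → Fin N)),
      Q.IsFFBSi y T P ξ I J →
      ∀ ε : ℝ, 0 < ε →
      ∀ h : (Fin (T + 1) → X) → ℝ, Measurable h → (∃ K, ∀ x, |h x| ≤ K) →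
        (osc h ≠ 0 →
          P.real {ω | ε ≤ |ffbsiEstimator ξ J h ω - S.smoothing y T h|}
            ≤ B * Real.exp (-(C * N * ε ^ 2 / osc h ^ 2))) ∧
        (osc h = 0 →
          P.real {ω | ε ≤ |ffbsiEstimator ξ J h ω - S.smoothing y T h|} = 0) := by
  obtain ⟨hg, Kg₀, hKg₀⟩ := hS
  obtain ⟨⟨κ₀, hκ₀⟩, K₀, hK₀init, hK₀⟩ := hQ
  -- Adding one makes the bounds strictly positive, as the deviation bound assumes.
  have hKg : ∀ s ≤ T, ∀ x, S.g x (y s) ≤ Kg₀ + 1 := fun s hs x =>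
    (hKg₀ s hs x).trans (by simp)
  have hκ : ∀ t, 1 ≤ t → t ≤ T → ∀ x, Q.ϑ t x ≤ κ₀ + 1 := fun t h1 h2 x =>
    (hκ₀ t h1 h2 x).trans (by simp)
  have hKle : (K₀ : ℝ≥0∞) ≤ ((K₀ + 1 : ℝ≥0) : ℝ≥0∞) := ENNReal.coe_le_coe.2 (by simp)
  have hKinit : ∀ᵐ x ∂Q.ρ₀, Q.weightFun₀ y x ≤ ((K₀ + 1 : ℝ≥0) : ℝ≥0∞) :=
    hK₀init.mono fun x hx => hx.trans hKle
  have hK : ∀ t, 1 ≤ t → t ≤ T → ∀ x x', Q.weightFun y t x x' ≤ ((K₀ + 1 : ℝ≥0) : ℝ≥0∞) :=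
    fun t h1 h2 x x' => (hK₀ t h1 h2 x x').trans hKle
  obtain ⟨B, C, hB, hC, hBC⟩ := AuxiliaryProposal.exists_deviation_bound (Q := Q) (y := y)
    (K := K₀ + 1) (Kg := Kg₀ + 1) (κ := κ₀ + 1) (by positivity) (by positivity) (by positivity)
    hKinit hK hκ hg hKg T le_rfl
  -- The error is split into two halves `ε / 2`: relative accuracy `ε / (2 * M)` for the forward
  -- estimate gives `C / 4`, and Hoeffding for the backward draws gives `1 / 8`.
  refine ⟨B + 2, min (C / 4) (1 / 8), by positivity, by positivity, ?_⟩
  intro N hN Ω _ P _ ξ I J hI ε hε h hh hb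
  have := S.isProb_init
  obtain ⟨x₀⟩ : Nonempty X := nonempty_of_isProbabilityMeasure S.init
  have hosc0 : 0 ≤ osc h := (abs_nonneg _).trans (abs_sub_le_osc hb (fun _ => x₀) (fun _ => x₀))
  have hshift : ∀ c, S.smoothing y T (fun x => h x - c) = S.smoothing y T h - c := fun c => by
    obtain ⟨Kh, hKh⟩ := hb
    exact StateSpaceModel.smoothing_sub_const hg hKg hh hKh c
  -- Both quantities are averages of `h`. Hence only `ε ≤ osc h` matters, which provides the
  -- restriction to relative accuracy at most one.
  have hle : ∀ ω, |ffbsiEstimator ξ J h ω - S.smoothing y T h| ≤ osc h := by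
    intro ω
    rw [abs_sub_comm, ← hshift]
    exact StateSpaceModel.abs_smoothing_le hg hKg
      (abs_sub_ffbsiEstimator_le_osc hN ξ J hb ω)
  have hempty : osc h < ε →
      {ω | ε ≤ |ffbsiEstimator ξ J h ω - S.smoothing y T h|} = ∅ := by
    intro hlt
    exact Set.eq_empty_of_forall_notMem fun ω hω => absurd (hω.trans (hle ω)) (not_le.2 hlt)
  refine ⟨fun hne => ?_, fun h0 => by rw [hempty (by rwa [h0])]; simp⟩
  rcases lt_or_ge (osc h) ε with hlt | hge
  · rw [hempty hlt, measureReal_empty]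
    positivity
  set M := osc h with hMdef
  have hM : 0 < M := lt_of_le_of_ne hosc0 hne.symm
  -- Subtracting a value of `h` changes neither error and makes the function bounded by its
  -- oscillation.
  set c := h fun _ => x₀
  have hf : Measurable fun x => h x - c := hh.sub_const c
  have hfM : ∀ x, |h x - c| ≤ M := fun x => abs_sub_le_osc hb _ _
  have hN' : (0 : ℝ) < N := by exact_mod_cast hN
  have h1 := hBC N hN Ω P ξ I J hI _ hf M hM hfM (ε / (2 * M)) (by positivity)
    (by rw [div_le_one (by positivity)]; linarith)
  have h2 := AuxiliaryProposal.measure_ffbsiEstimator_sub_estimate_ge_le hN hI hK hf hM hfM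
    (δ := ε / 2) (by positivity)
  have e1 : min (C / 4) (1 / 8) * N * ε ^ 2 / M ^ 2 ≤ C * N * (ε / (2 * M)) ^ 2 := by
    calc _ ≤ C / 4 * N * ε ^ 2 / M ^ 2 := by
          gcongr
          exact min_le_left _ _
      _ = _ := by
          field_simp
          ring
  have e2 : min (C / 4) (1 / 8) * N * ε ^ 2 / M ^ 2 ≤ N * (ε / 2) ^ 2 / (2 * M ^ 2) := by
    calc _ ≤ 1 / 8 * N * ε ^ 2 / M ^ 2 := by
          gcongr
          exact min_le_right _ _
      _ = _ := by
          field_simp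
          ring
  refine ENNReal.toReal_le_of_le_ofReal (by positivity) ?_
  refine le_trans (measure_mono ?_) ((measure_union_le _ _).trans ((add_le_add
    (h1.trans (AuxiliaryProposal.ofReal_exp_le_of_le hB.le e1))
    (h2.trans (AuxiliaryProposal.ofReal_exp_le_of_le zero_le_two e2))).trans (le_of_eq ?_)))
  · intro ω hω
    by_contra hcon
    simp only [Set.mem_union, Set.mem_ofPred_eq, not_or, not_and, not_le, Classical.not_imp]
      at hcon
    obtain ⟨⟨hω', hc1⟩, hc2⟩ := hcon
    replace hc2 := hc2 hω'
    rw [ffbsiEstimator_sub_const hN] at hc2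
    rw [hshift, show ε / (2 * M) * M = ε / 2 by field_simp] at hc1
    refine absurd (show ε ≤ |ffbsiEstimator ξ J h ω - S.smoothing y T h| from hω) (not_le.2 ?_)
    calc |ffbsiEstimator ξ J h ω - S.smoothing y T h|
        = |(ffbsiEstimator ξ J h ω - c - Q.estimate y ξ I T (fun x => h x - c) ω) +
          (Q.estimate y ξ I T (fun x => h x - c) ω - (S.smoothing y T h - c))| := by ring_nf
      _ < ε := (abs_add_le _ _).trans_lt (by linarith)
  · rw [← ENNReal.ofReal_add (by positivity) (by positivity), add_mul]
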